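/- Let $M,K,N,N_{\mathrm t}$ be natural numbers. Given are channels $\mathbf h_{i,m,k}\in\mathbb C^{N_{\mathrm t}}$ from base station (BS) $i$ to the $k$-th user of BS $m$, steering vectors $\mathbf a(\theta_m)\in\mathbb C^{N_{\mathrm t}}$, coefficients $\varepsilon_{m,n}\in\mathbb C$, a real $2\times MN$ matrix $\boldsymbol\Lambda$, and real numbers $T,\beta,\sigma_{\mathrm s},\sigma_{\mathrm n},\eta>0$ and $P$. For $\mathbf q\in\mathbb R^M$ let $\hat{\mathbf Z}(\mathbf q)=\mathrm{diag}(q_1\hat{\mathbf Z}_1,\dots,q_M\hat{\mathbf Z}_M)$ with $\hat{\mathbf Z}_m=\frac{8\pi^2T\beta^2}{\sigma_{\mathrm s}^2}\mathrm{diag}(|\varepsilon_{m,1}|^2,\dots,|\varepsilon_{m,N}|^2)$, and let $\varphi(\mathbf q)=\mathrm{tr}\big((\boldsymbol\Lambda\hat{\mathbf Z}(\mathbf q)\boldsymbol\Lambda^T)^{-1}\big)$, with domain $\{\mathbf q:\boldsymbol\Lambda\hat{\mathbf Z}(\mathbf q)\boldsymbol\Lambda^T\succ0\}$. For beamformers $\mathbf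 f=\{\mathbf f_{m,k}\}$ put $g_m(\mathbf f)=\sum_k|\mathbf a(\theta_m)^T\mathbf f_{m,k}|^2$, $\omega_{m,k}(\mathbf f)=\sum_{(i,j)\ne(m,k)}|\mathbf h_{i,m,k}^H\mathbf f_{i,j}|^2$, $\mathrm{SINR}_{m,k}(\mathbf f)=|\mathbf h_{m,m,k}^H\mathbf f_{m,k}|^2/(\omega_{m,k}(\mathbf f)+\sigma_{\mathrm n}^2)$ and $C(\mathbf f)=\varphi(g_1(\mathbf f),\dots,g_M(\mathbf f))$ (the Cramér–Rao bound). The sensing-centric problem is $$\text{(P)}\quad\min_{\mathbf f}\ C(\mathbf f)\quad\text{s.t.}\quad \textstyle\sum_k\|\mathbf f_{m,k}\|^2\le P\ \ \forall m,\qquad \mathrm{SINR}_{m,k}(\mathbf f)\ge\eta\ \ \forall m,k,$$ over the $\mathbf f$ at which $C$ is defined. The SCA algorithm starts at $(\mathbf f^{(0)},\rho^{(0)},u^{(0)})$ that, together with some $\mathbf q$ in the domain of $\varphi$, satisfies $\sum_k\|\mathbf f_{m,k}\|^2\le P$, $q_m\le g_m(\mathbf f)$, $\rho_{m,k}^2/u_{m,k}\ge\eta$,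 $|\mathbf h_{m,m,k}^H\mathbf f_{m,k}|^2\ge\rho_{m,k}^2$ and $\sigma_{\mathrm n}^2+\omega_{m,k}(\mathbf f)\le u_{m,k}$ for all $m,k$. For $r=0,1,\dots$ it takes as $(\mathbf f^{(r+1)},\rho^{(r+1)},u^{(r+1)})$ the corresponding part of an (arbitrary) optimal solution of the convex problem of minimizing $\varphi(\mathbf q)$ over $(\mathbf f,\rho,u,\mathbf q)$ subject, for all $m,k$, to $\sum_k\|\mathbf f_{m,k}\|^2\le P$, $\sigma_{\mathrm n}^2+\omega_{m,k}(\mathbf f)\le u_{m,k}$, $$q_m\le\sum_k\Big(2\,\mathrm{Re}\big(\overline{\mathbf a(\theta_m)^T\mathbf f_{m,k}}\;\mathbf a(\theta_m)^T\mathbf f_{m,k}^{(r)}\big)-|\mathbf a(\theta_m)^T\mathbf f_{m,k}^{(r)}|^2\Big),\qquad \frac{2\rho_{m,k}^{(r)}}{u_{m,k}^{(r)}}\rho_{m,k}-\Big(\frac{\rho_{m,k}^{(r)}}{u_{m,k}^{(r)}}\Big)^2u_{m,k}\ge\eta,$$ $$2\,\mathrm{Re}\big(\mathbf f_{m,k}^H\mathbf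 h_{m,m,k}\mathbf h_{m,m,k}^H\mathbf f_{m,k}^{(r)}\big)-|\mathbf h_{m,m,k}^H\mathbf f_{m,k}^{(r)}|^2\ge\rho_{m,k}^2 .$$ Assume that some $\mathbf f$ with $\sum_k\|\mathbf f_{m,k}\|^2\le P$ for all $m$ satisfies $\mathrm{SINR}_{m,k}(\mathbf f)>\eta$ for all $m,k$. Then the algorithm is well defined: for every feasible $\mathbf f^{(0)}$ of (P) there is a run starting at it, and at every admissible point (one satisfying the conditions imposed on the starting point) the surrogate problem has an optimal solution. Every run converges to KKT points of (P) in the following sense: all $\mathbf f^{(r)}$ are feasible for (P); the values $C(\mathbf f^{(r)})$ are nonincreasing; $(\mathbf f^{(r)})$ has a limit point; every limit point $\bar{\mathbf f}$ is a KKT point of (P) and $C(\mathbf f^{(r)})\to C(\bar{\mathbf f})$; the distance of $\mathbf f^{(r)}$ to the set of KKT points of (P) tends to $0$; and if $\mathbf f^{(r+1)}=\mathbf f^{(r)}$ for some $r$, then $\mathbf f^{(r)}$ is a KKT point of (P). -/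

import Mathlib

open Filter Topology

noncomputable section

/-- A family of transmit beamformers `f m k ∈ ℂ^Nt`, one for each base station `m` and each
user `k` served by it. -/
abbrev Beamformers (M K Nt : ℕ) : Type := Fin M → Fin K → EuclideanSpace ℂ (Fin Nt)

/-- The data of a networked integrated sensing and communication system with `M` base stations
having `Nt` antennas each, `K` users per base station, `N` target-monitoring receivers and one
target in the plane. -/
structure ISACNetwork (M K N Nt : ℕ) where
  /-- `h i m k` is the channel from base station `i` to the `k`-th user of base station `m`. -/
  h : Fin M → Fin M → Fin K → EuclideanSpace ℂ (Fin Nt)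
  /-- `a m` is the steering vector `a(θ_m)` of base station `m` towards the target. -/
  a : Fin M → EuclideanSpace ℂ (Fin Nt)
  /-- reflection/path-loss coefficient of the path base station `m` - target - receiver `n` -/
  ε : Fin M → Fin N → ℂ
  /-- the `2 × MN` matrix `Λ` relating the path delays to the target coordinates -/
  Lam : Matrix (Fin 2) (Fin M × Fin N) ℝ
  /-- observation time -/
  T : ℝ
  /-- effective bandwidth -/
  β : ℝ
  /-- standard deviation of the sensing noise -/
  σs : ℝ
  /-- standard deviation of the communication noise -/
  σn : ℝ
  /-- power budget of each base station -/
  P : ℝ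
  /-- SINR threshold -/
  η : ℝ

/-- An iterate of the algorithm: beamformers together with the auxiliary variables `ρ`, `u`. -/
structure SCAState (M K Nt : ℕ) where
  f : Beamformers M K Nt
  ρ : Fin M → Fin K → ℝ
  u : Fin M → Fin K → ℝ

/-- `x` is a Karush-Kuhn-Tucker point of: minimize `F` subject to `g i ≤ 0` for all `i`. -/
def IsKKT {E ι : Type*} [NormedAddCommGroup E] [NormedSpace ℝ E] [Fintype ι]
    (F : E → ℝ) (g : ι → E → ℝ) (x : E) : Prop :=
  (∀ i, g i x ≤ 0) ∧
  ∃ (F' : E →L[ℝ] ℝ) (g' : ι → E →L[ℝ] ℝ) (mult : ι → ℝ),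
    HasFDerivAt F F' x ∧ (∀ i, HasFDerivAt (g i) (g' i) x) ∧
    (∀ i, 0 ≤ mult i) ∧ (∀ i, mult i * g i x = 0) ∧
    F' + ∑ i, mult i • g' i = 0

namespace ISACNetwork

variable {M K N Nt : ℕ} (S : ISACNetwork M K N Nt)

/-- The scalar `a(θ_m)ᵀ v`. -/
def steer (m : Fin M) (v : EuclideanSpace ℂ (Fin Nt)) : ℂ := ∑ n, S.a m n * v n

/-- The power `a(θ_m)ᵀ (∑_k f_{m,k} f_{m,k}ᴴ) a(θ_m)^* = ∑_k |a(θ_m)ᵀ f_{m,k}|²` radiated by base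
station `m` towards the target. -/
def gain (f : Beamformers M K Nt) (m : Fin M) : ℝ := ∑ k, ‖S.steer m (f m k)‖ ^ 2

/-- The block-diagonal matrix `diag (q_1 Ẑ_1, …, q_M Ẑ_M)` with
`Ẑ_m = (8 π² T β² / σ_s²) diag (|ε_{m,1}|², …, |ε_{m,N}|²)`. -/
def Zhat (q : Fin M → ℝ) : Matrix (Fin M × Fin N) (Fin M × Fin N) ℝ :=
  Matrix.diagonal fun p =>
    q p.1 * (8 * Real.pi ^ 2 * S.T * S.β ^ 2 / S.σs ^ 2 * ‖S.ε p.1 p.2‖ ^ 2)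

/-- The `2 × 2` information matrix `Λ Ẑ Λᵀ`. -/
def info (q : Fin M → ℝ) : Matrix (Fin 2) (Fin 2) ℝ := S.Lam * S.Zhat q * S.Lam.transpose

/-- The objective `tr ((Λ Ẑ Λᵀ)⁻¹)`; its domain consists of the `q` with `Λ Ẑ Λᵀ` positive
definite. -/
def traceInv (q : Fin M → ℝ) : ℝ := ((S.info q)⁻¹).trace

/-- The Cramér-Rao lower bound `C_{x,y} = tr ((Λ Z Λᵀ)⁻¹)` as a function of the beamformers. -/
def crlb (f : Beamformers M K Nt) : ℝ := S.traceInv (S.gain f)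

/-- The interference `ω({f_{i,j}}, m, k)` at the `k`-th user of base station `m`. -/
def interference (f : Beamformers M K Nt) (m : Fin M) (k : Fin K) : ℝ :=
  ∑ p : Fin M × Fin K with p ≠ (m, k), ‖inner ℂ (S.h p.1 m k) (f p.1 p.2)‖ ^ 2

/-- The signal-to-interference-plus-noise ratio of the `k`-th user of base station `m`. -/
def sinr (f : Beamformers M K Nt) (m : Fin M) (k : Fin K) : ℝ :=
  ‖inner ℂ (S.h m m k) (f m k)‖ ^ 2 / (S.interference f m k + S.σn ^ 2)

/-- The transmit power of base station `m`. -/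
def power (f : Beamformers M K Nt) (m : Fin M) : ℝ := ∑ k, ‖f m k‖ ^ 2

/-- The constraint functions of the sensing-centric problem, in the form `≤ 0`. -/
def constraint : Fin M ⊕ (Fin M × Fin K) → Beamformers M K Nt → ℝ
  | .inl m => fun f => power f m - S.P
  | .inr p => fun f => S.η - S.sinr f p.1 p.2

/-- Feasible points of the sensing-centric problem
`minimize C_{x,y}  subject to  ∑_k ‖f_{m,k}‖² ≤ P,  SINR_{m,k} ≥ η`
at which the objective is defined. -/
def Feasible (f : Beamformers M K Nt) : Prop :=
  (S.info (S.gain f)).PosDef ∧ ∀ i, S.constraint i f ≤ 0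

/-- KKT points of the sensing-centric problem. -/
def IsKKTPoint (f : Beamformers M K Nt) : Prop :=
  (S.info (S.gain f)).PosDef ∧ IsKKT S.crlb S.constraint f

/-- Feasible points of the reformulated problem in the variables `f, ρ, u, q`. -/
structure ReformFeasible (x : SCAState M K Nt) (q : Fin M → ℝ) : Prop where
  dom : (S.info q).PosDef
  power_le : ∀ m, power x.f m ≤ S.P
  le_gain : ∀ m, q m ≤ S.gain x.f m
  ratio : ∀ m k, S.η ≤ x.ρ m k ^ 2 / x.u m k
  signal : ∀ m k, x.ρ m k ^ 2 ≤ ‖inner ℂ (S.h m m k) (x.f m k)‖ ^ 2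
  noise : ∀ m k, S.σn ^ 2 + S.interference x.f m k ≤ x.u m k

/-- Feasible points `(y, q)` of the convex surrogate problem built at the current iterate `x`.
In `le_gain` the right-hand side is
`2 Re (f_mᴴ D_m f_m^{(r)}) - (f_m^{(r)})ᴴ D_m f_m^{(r)}` with `D_m = I_K ⊗ (a^* aᵀ)`, written out
over the blocks `k`. -/
structure SurrogateFeasible (x y : SCAState M K Nt) (q : Fin M → ℝ) : Prop where
  dom : (S.info q).PosDef
  power_le : ∀ m, power y.f m ≤ S.P
  le_gain : ∀ m, q m ≤
    2 * (∑ k, star (S.steer m (y.f m k)) * S.steer m (x.f m k)).re - S.gain x.f m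
  ratio : ∀ m k, S.η ≤
    2 * x.ρ m k / x.u m k * y.ρ m k - x.ρ m k ^ 2 / x.u m k ^ 2 * y.u m k
  signal : ∀ m k, y.ρ m k ^ 2 ≤
    2 * (inner ℂ (y.f m k) (S.h m m k) * inner ℂ (S.h m m k) (x.f m k)).re
      - ‖inner ℂ (S.h m m k) (x.f m k)‖ ^ 2
  noise : ∀ m k, S.σn ^ 2 + S.interference y.f m k ≤ y.u m k

/-- `y` is (the part kept by the algorithm of) an optimal solution of the surrogate problem
built at `x`. -/
def IsSurrogateSolution (x y : SCAState M K Nt) : Prop :=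
  ∃ q, S.SurrogateFeasible x y q ∧
    ∀ y' q', S.SurrogateFeasible x y' q' → S.traceInv q ≤ S.traceInv q'

/-- A run of the successive convex approximation algorithm: it starts at a feasible point, and
each iterate is an optimal solution of the surrogate problem built at the preceding one. -/
structure IsSCARun (x : ℕ → SCAState M K Nt) : Prop where
  init : ∃ q, S.ReformFeasible (x 0) q
  step : ∀ r, S.IsSurrogateSolution (x r) (x (r + 1))

end ISACNetwork

end

/-!
The proof avoids duality for the convex surrogate problems. It shows directly that the surrogate
problem built at a point which is not KKT contains a *robust* improvement.

Gains, powers, signals and interferences are quadratic forms `∑ |L_p f|²` of the beamformers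
(`quadForm`). Such a form lies above its tangents, so the surrogate problem is an inner
approximation of the original one that is exact at the current iterate
(`SurrogateFeasible.reformFeasible`, `ReformFeasible.surrogateFeasible_self`). The objective
`q ↦ tr ((Λ Ẑ Λᵀ)⁻¹)` is antitone in the gains (`posDef_and_traceInv_le_of_le`), and hence the
bounds are nonincreasing along a run. It also blows up at the boundary of its domain: its sublevel
sets are closed (`isClosed_traceInv_le`). Together with the compactness of the set of admissible
points (`exists_isCompact_reformFeasible`) this yields solutions of the surrogate problems, and
limit points of a run stay admissible. For `2 × 2` matrices, `tr A⁻¹ = tr A / det A` makes both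
facts about the objective elementary.

Let now `f` be feasible but not a KKT point. The Slater point, with its beams rotated so that the
useful signals have the phases of those of `f`, gives a Mangasarian-Fromovitz direction
(`Feasible.exists_constraintDeriv_neg`). Separating the range of the derivatives from the open
negative orthant (`isKKT_of_no_descent`) then provides a direction `d` along which the objective
and all active constraints strictly decrease. Moving along `d`, with `ρ` and `u` moving at suitable
speeds, produces a point that satisfies the surrogate constraints at `f` strictly and has a
smaller objective value (`ReformFeasible.exists_strictly_better`). By continuity this point is
feasible for the surrogate problems at all nearby iterates, so near `f` each step would push
the bound below a fixed value less than that at `f`. At a limit point of the run this contradicts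
the convergence of the monotone bounds, and at a repeated iterate it contradicts optimality
directly. The distance to the set of KKT points tends to `0` because the iterates stay in a compact
set.
-/

noncomputable section

/-! ### Sums of squared moduli of linear maps -/

section QuadForm

variable {E ι : Type*} [NormedAddCommGroup E] [NormedSpace ℝ E]

/-- The quadratic form `f ↦ ∑ p ∈ s, |L p f|²` on a real normed space `E`. -/
def quadForm (s : Finset ι) (L : ι → E →L[ℝ] ℂ) (f : E) : ℝ := ∑ p ∈ s, ‖L p f‖ ^ 2

/-- The polar form `∑ p ∈ s, Re (conj (L p f) * L p d)` of `quadForm s L`, as a continuous linear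
map in `d`. -/
def polarForm (s : Finset ι) (L : ι → E →L[ℝ] ℂ) (f : E) : E →L[ℝ] ℝ :=
  ∑ p ∈ s, (innerSL ℝ (L p f)).comp (L p)

variable (s : Finset ι) (L : ι → E →L[ℝ] ℂ)

lemma polarForm_apply (f d : E) :
    polarForm s L f d = ∑ p ∈ s, (star (L p f) * L p d).re := by
  simp [polarForm, Complex.inner, mul_comm]

lemma polarForm_self (f : E) : polarForm s L f f = quadForm s L f := by
  simp [polarForm, quadForm]

lemma polarForm_comm (f d : E) : polarForm s L f d = polarForm s L d f := by
  simp only [polarForm, _root_.sum_apply]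
  exact Finset.sum_congr rfl fun p _ => real_inner_comm (L p d) (L p f)

lemma quadForm_nonneg (f : E) : 0 ≤ quadForm s L f :=
  Finset.sum_nonneg fun _ _ => sq_nonneg _

lemma quadForm_smul (t : ℝ) (f : E) : quadForm s L (t • f) = t ^ 2 * quadForm s L f := by
  simp [quadForm, mul_pow, Finset.mul_sum]

lemma quadForm_add (f d : E) :
    quadForm s L (f + d) = quadForm s L f + 2 * polarForm s L f d + quadForm s L d := by
  simp only [quadForm, polarForm, _root_.sum_apply, map_add, Finset.mul_sum,
    ← Finset.sum_add_distrib]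
  exact Finset.sum_congr rfl fun p _ => norm_add_sq_real _ _

lemma quadForm_add_smul (f d : E) (t : ℝ) :
    quadForm s L (f + t • d) =
      quadForm s L f + t * (2 * polarForm s L f d) + t ^ 2 * quadForm s L d := by
  rw [quadForm_add, quadForm_smul, map_smul, smul_eq_mul]; ring

/-- A convex quadratic form lies above its tangents. -/
lemma tangent_le_quadForm (f y : E) :
    2 * polarForm s L f y - quadForm s L f ≤ quadForm s L y := by
  have h := quadForm_nonneg s L (y - f)
  have e := quadForm_add s L f (y - f)
  rw [add_sub_cancel, map_sub, polarForm_self] at e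
  linarith

/-- Young's inequality for the polar form, with a free weight `c`. -/
lemma two_mul_polarForm_le (f y : E) {c : ℝ} (hc : 0 < c) :
    2 * polarForm s L f y ≤ c * quadForm s L f + c⁻¹ * quadForm s L y := by
  have h := tangent_le_quadForm s L (c • f) y
  rw [quadForm_smul, polarForm_comm, map_smul, smul_eq_mul, polarForm_comm] at h
  have := mul_le_mul_of_nonneg_left h (inv_pos.2 hc).le
  have e : c⁻¹ * (2 * (c * polarForm s L f y) - c ^ 2 * quadForm s L f)
      = 2 * polarForm s L f y - c * quadForm s L f := by field_simp
  linarith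

lemma hasFDerivAt_quadForm (f : E) :
    HasFDerivAt (quadForm s L) ((2 : ℝ) • polarForm s L f) f := by
  have h : HasFDerivAt (fun y => ∑ p ∈ s, ‖L p y‖ ^ 2)
      (∑ p ∈ s, 2 • (innerSL ℝ (L p f)).comp (L p)) f :=
    HasFDerivAt.fun_sum fun p _ => (L p).hasFDerivAt.norm_sq
  refine h.congr_fderiv ?_
  ext d
  simp [polarForm, Finset.mul_sum, mul_add]

@[fun_prop]
lemma continuous_quadForm : Continuous (quadForm s L) := by
  unfold quadForm; fun_prop

lemma Filter.Tendsto.polarForm {α : Type*} {l : Filter α} {u v : α → E} {f d : E}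
    (hu : Tendsto u l (𝓝 f)) (hv : Tendsto v l (𝓝 d)) :
    Tendsto (fun r => polarForm s L (u r) (v r)) l (𝓝 (polarForm s L f d)) := by
  simp only [polarForm_apply]
  exact tendsto_finsetSum _ fun p _ => (Complex.continuous_re.tendsto _).comp
    (((L p).continuous.tendsto _ |>.comp hu).star.mul ((L p).continuous.tendsto _ |>.comp hv))

end QuadForm

/-! ### Multipliers -/

/-- Fritz John multipliers: if finitely many functionals have no common direction of strict
decrease, a nontrivial nonnegative combination of them vanishes. -/
lemma exists_nonneg_combination_eq_zero {E ι : Type*} [NormedAddCommGroup E] [NormedSpace ℝ E]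
    [Fintype ι] [Nonempty ι] (G : ι → E →L[ℝ] ℝ) (h : ¬ ∃ d, ∀ i, G i d < 0) :
    ∃ w : ι → ℝ, (∀ i, 0 ≤ w i) ∧ (∃ i, 0 < w i) ∧ ∀ d, ∑ i, w i * G i d = 0 := by
  classical
  let s : Set (ι → ℝ) := Set.univ.pi fun _ => Set.Iio 0
  let V : Submodule ℝ (ι → ℝ) := LinearMap.range (LinearMap.pi fun i => (G i).toLinearMap)
  have hs : Convex ℝ s := convex_pi fun _ _ => convex_Iio 0
  have hso : IsOpen s := isOpen_set_pi Set.finite_univ fun _ _ => isOpen_Iio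
  have hdisj : Disjoint s (V : Set (ι → ℝ)) := by
    rw [Set.disjoint_left]
    rintro _ hx ⟨d, rfl⟩
    exact h ⟨d, fun i => by simpa using hx i trivial⟩
  obtain ⟨φ, c, hφs, hφV⟩ := geometric_hahn_banach_open hs hso V.convex hdisj
  -- a functional bounded below on a subspace vanishes there
  have hV0 : ∀ v ∈ V, φ v = 0 := by
    intro v hv
    by_contra hne
    have := hφV (((c - 1) / φ v) • v) (V.smul_mem _ hv)
    rw [map_smul, smul_eq_mul, div_mul_cancel₀ _ hne] at this
    linarith
  have hc : c ≤ 0 := by simpa using hφV 0 V.zero_mem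
  have hrep : ∀ v : ι → ℝ, φ v = ∑ i, φ (Pi.single i 1) * v i := by
    intro v
    conv_lhs => rw [pi_eq_sum_univ' v]
    simp only [map_sum, map_smul, smul_eq_mul]
    refine Finset.sum_congr rfl fun i _ => ?_
    rw [mul_comm]
  have hnn : ∀ i, 0 ≤ φ (Pi.single i 1) := by
    intro i
    by_contra! hneg
    -- far out in the `i`-th direction of the orthant `φ` would be positive
    let A : ℝ := ∑ j, φ (Pi.single j 1)
    have hmem : ∀ t : ℝ, 0 ≤ t → φ (fun j => -1 - t * Pi.single (M := fun _ => ℝ) i 1 j) < 0 := by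
      intro t ht
      refine (hφs _ fun j _ => ?_).trans_le hc
      have : (0 : ℝ) ≤ Pi.single (M := fun _ => ℝ) i 1 j := by
        by_cases hj : j = i
        · subst hj; simp
        · simp [hj]
      simp only [Set.mem_Iio]; nlinarith
    have hval : ∀ t : ℝ, φ (fun j => -1 - t * Pi.single (M := fun _ => ℝ) i 1 j)
        = -A - t * φ (Pi.single i 1) := by
      intro t
      rw [hrep]
      simp only [mul_sub, Finset.sum_sub_distrib, A, mul_neg, mul_one, Finset.sum_neg_distrib]
      congr 1
      rw [Finset.sum_eq_single i]
      · simp [mul_comm]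
      · intro j _ hj; simp [hj]
      · simp
    have h1 := hmem (|A| / -φ (Pi.single i 1)) (by apply div_nonneg (abs_nonneg _); linarith)
    rw [hval, div_neg, neg_mul, div_mul_cancel₀ _ hneg.ne] at h1
    linarith [le_abs_self A]
  refine ⟨fun i => φ (Pi.single i 1), hnn, ?_, fun d => ?_⟩
  · by_contra! hle
    have h1 := hφs (fun _ => -1) (fun i _ => by simp)
    rw [hrep] at h1
    have : ∀ i, φ (Pi.single i 1) = 0 := fun i => le_antisymm (hle i) (hnn i)
    simp [this] at h1
    linarith
  · have := hV0 _ ⟨d, rfl⟩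
    rw [hrep] at this
    simpa using this

/-- Karush-Kuhn-Tucker conditions in primal form: under the Mangasarian-Fromovitz condition
`hd₀`, a feasible point at which no direction strictly decreases the objective and all active
constraints is a KKT point. -/
lemma isKKT_of_no_descent {E ι : Type*} [NormedAddCommGroup E] [NormedSpace ℝ E] [Fintype ι]
    {F : E → ℝ} {g : ι → E → ℝ} {x : E} {F' : E →L[ℝ] ℝ} {g' : ι → E →L[ℝ] ℝ}
    (hx : ∀ i, g i x ≤ 0) (hF : HasFDerivAt F F' x) (hg : ∀ i, HasFDerivAt (g i) (g' i) x)
    {d₀ : E} (hd₀ : ∀ i, g i x = 0 → g' i d₀ < 0)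
    (h : ¬ ∃ d, F' d < 0 ∧ ∀ i, g i x = 0 → g' i d < 0) : IsKKT F g x := by
  classical
  let G : Option {i // g i x = 0} → E →L[ℝ] ℝ := fun o => o.elim F' fun i => g' i
  obtain ⟨w, hw, ⟨i₀, hi₀⟩, hsum⟩ := exists_nonneg_combination_eq_zero G (by
    rintro ⟨d, hd⟩
    exact h ⟨d, hd none, fun i hi => hd (some ⟨i, hi⟩)⟩)
  simp only [Fintype.sum_option, G, Option.elim] at hsum
  have hw0 : 0 < w none := by
    refine (hw none).lt_of_ne' fun h0 => ?_
    have h1 := hsum d₀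
    rw [h0, zero_mul, zero_add] at h1
    have hle : ∀ i ∈ Finset.univ, w (some i) * g' i d₀ ≤ 0 := fun i _ =>
      mul_nonpos_of_nonneg_of_nonpos (hw _) (hd₀ i i.2).le
    have h2 := (Finset.sum_eq_zero_iff_of_nonpos hle).1 h1
    match i₀, hi₀ with
    | none, hi => exact hi.ne' h0
    | some i, hi =>
      have := h2 i (Finset.mem_univ i)
      exact (mul_neg_of_pos_of_neg hi (hd₀ i i.2)).ne this
  let c : ι → ℝ := fun i => if hi : g i x = 0 then w (some ⟨i, hi⟩) / w none else 0
  refine ⟨hx, F', g', c, hF, hg, fun i => ?_, fun i => ?_, ?_⟩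
  · simp only [c]; split_ifs
    · exact div_nonneg (hw _) hw0.le
    · exact le_rfl
  · by_cases hi : g i x = 0 <;> simp [c, hi]
  · ext d
    have e : ∑ i, c i * g' i d = ∑ i : {i // g i x = 0}, w (some i) / w none * g' i d := by
      rw [← Fintype.sum_subtype_add_sum_subtype (fun i => g i x = 0) fun i => c i * g' i d]
      have h1 : ∑ i : {i // ¬ g i x = 0}, c i * g' i d = 0 :=
        Finset.sum_eq_zero fun i _ => by simp [c, i.2]
      rw [h1, add_zero]
      exact Finset.sum_congr rfl fun i _ => by simp [c, i.2]
    simp only [_root_.add_apply, _root_.sum_apply,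
      _root_.smul_apply, smul_eq_mul, _root_.zero_apply]
    rw [e]
    have h1 := hsum d
    have h2 : F' d + ∑ i : {i // g i x = 0}, w (some i) / w none * g' i d
      = (w none)⁻¹ * (w none * F' d + ∑ i : {i // g i x = 0}, w (some i) * g' i d) := by
      rw [mul_add, inv_mul_cancel_left₀ hw0.ne', Finset.mul_sum]
      congr 1
      exact Finset.sum_congr rfl fun i _ => by ring
    rw [h2, h1, mul_zero]

/-! ### Elementary lemmas on real and complex numbers -/

/-- A quadratic polynomial that is nonnegative at `0`, and increasing there if it vanishes, is
positive just after `0`. -/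
lemma eventually_pos_of_quadratic {a b c : ℝ} (ha : 0 ≤ a) (hb : a = 0 → 0 < b) :
    ∀ᶠ t : ℝ in 𝓝[>] 0, 0 < a + t * b + t ^ 2 * c := by
  rcases ha.eq_or_lt with h | h
  · have hb := hb h.symm
    have : Tendsto (fun t : ℝ => b + t * c) (𝓝[>] 0) (𝓝 (b + 0 * c)) :=
      (Continuous.tendsto (by fun_prop) 0).mono_left nhdsWithin_le_nhds
    filter_upwards [this.eventually_const_lt (by simpa using hb), self_mem_nhdsWithin] with t ht ht0
    have : 0 < t * (b + t * c) := mul_pos ht0 ht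
    rw [← h]; nlinarith
  · have : Tendsto (fun t : ℝ => a + t * b + t ^ 2 * c) (𝓝[>] 0) (𝓝 (a + 0 * b + 0 ^ 2 * c)) :=
      (Continuous.tendsto (by fun_prop) 0).mono_left nhdsWithin_le_nhds
    exact this.eventually_const_lt (by simpa using h)

lemma HasDerivAt.eventually_lt_of_neg {g : ℝ → ℝ} {g' x : ℝ} (h : HasDerivAt g g' x) (hg : g' < 0) :
    ∀ᶠ t in 𝓝[>] x, g t < g x := by
  have h1 := (hasDerivAt_iff_tendsto_slope.1 h).mono_left
    (nhdsWithin_mono x (fun t (ht : x < t) => ht.ne'))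
  filter_upwards [h1.eventually_lt_const hg, self_mem_nhdsWithin] with t ht ht0
  rw [slope_def_field, div_neg_iff] at ht
  have : x < t := ht0
  rcases ht with ht | ht <;> linarith [ht.1, ht.2]

/-- Slopes `u` and `z` with `η W < η u < z < A`, where each inequality is required only if the
corresponding constraint is tight (`p`, `r`, `q`). This is possible unless all three are tight, in
which case `η W < A` is needed. -/
lemma exists_intermediate_slopes {η W A : ℝ} {p q r : Prop} (hη : 0 < η)
    (h : p → q → r → η * W < A) :
    ∃ z u : ℝ, (p → W < u) ∧ (q → z < A) ∧ (r → η * u < z) := by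
  by_cases hp : p
  · by_cases hq : q
    · by_cases hr : r
      · have := h hp hq hr
        refine ⟨(A + (η * W + A) / 2) / 2, (η * W + A) / 2 / η, fun _ => ?_, fun _ => ?_,
          fun _ => ?_⟩
        · rw [lt_div_iff₀ hη]; linarith
        · linarith
        · rw [mul_div_cancel₀ _ hη.ne']; linarith
      · exact ⟨A - 1, W + 1, fun _ => by linarith, fun _ => by linarith, fun h => absurd h hr⟩
    · exact ⟨η * (W + 1) + 1, W + 1, fun _ => by linarith, fun h => absurd h hq,
        fun _ => by linarith⟩
  · refine ⟨A - 1, (A - 2) / η, fun h => absurd h hp, fun _ => by linarith, fun _ => ?_⟩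
    rw [mul_div_cancel₀ _ hη.ne']; linarith

/-- Two complex numbers can be given the same phase by rotating one of them. -/
lemma Complex.exists_norm_eq_one_re_conj_mul (a b : ℂ) (ha : a ≠ 0) (hb : b ≠ 0) :
    ∃ c : ℂ, ‖c‖ = 1 ∧ (star a * (c * b)).re = ‖a‖ * ‖b‖ := by
  have ha' := norm_ne_zero_iff.2 ha
  have hb' := norm_ne_zero_iff.2 hb
  refine ⟨a * star b / (‖a‖ * ‖b‖ : ℝ), ?_, ?_⟩
  · rw [norm_div, norm_mul, norm_star, Complex.norm_real, Real.norm_of_nonneg (by positivity),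
      div_self (by positivity)]
  · have e : star a * (a * star b / (‖a‖ * ‖b‖ : ℝ) * b) =
        ((‖a‖ * ‖b‖ : ℝ) : ℂ) := by
      have h1 : star a * a = ((‖a‖ ^ 2 : ℝ) : ℂ) := by
        have := Complex.conj_mul' a
        push_cast; exact this
      have h2 : star b * b = ((‖b‖ ^ 2 : ℝ) : ℂ) := by
        have := Complex.conj_mul' b
        push_cast; exact this
      have h3 : ((‖a‖ * ‖b‖ : ℝ) : ℂ) ≠ 0 := by
        exact_mod_cast mul_ne_zero ha' hb'
      calc _ = (star a * a) * (star b * b) / ((‖a‖ * ‖b‖ : ℝ) : ℂ) := by ring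
        _ = _ := by
          rw [h1, h2, div_eq_iff h3]
          push_cast; ring
    rw [e, Complex.ofReal_re]

/-! ### Positive definite `2 × 2` matrices -/

lemma Matrix.posDef_fin_two_iff {A : Matrix (Fin 2) (Fin 2) ℝ} (hA : A 1 0 = A 0 1) :
    A.PosDef ↔ 0 < A 0 0 ∧ 0 < A 0 0 * A 1 1 - A 0 1 ^ 2 := by
  constructor
  · intro h
    have h2 := h.det_pos
    rw [Matrix.det_fin_two, hA] at h2
    exact ⟨h.diag_pos, by linarith⟩
  · rintro ⟨h1, h2⟩
    refine .of_dotProduct_mulVec_pos ?_ fun v hv => ?_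
    · ext i j; fin_cases i <;> fin_cases j <;> simp [hA]
    · simp only [star_trivial, Matrix.mulVec, dotProduct, Fin.sum_univ_two, hA]
      have hv' : v 0 ≠ 0 ∨ v 1 ≠ 0 := by
        by_contra! hc
        exact hv (by ext i; fin_cases i <;> simp [hc.1, hc.2])
      have key : 0 < A 0 0 *
          (v 0 * (A 0 0 * v 0 + A 0 1 * v 1) + v 1 * (A 0 1 * v 0 + A 1 1 * v 1)) := by
        have e : A 0 0 * (v 0 * (A 0 0 * v 0 + A 0 1 * v 1) + v 1 * (A 0 1 * v 0 + A 1 1 * v 1))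
          = (A 0 0 * v 0 + A 0 1 * v 1) ^ 2 + (A 0 0 * A 1 1 - A 0 1 ^ 2) * v 1 ^ 2 := by ring
        rw [e]
        by_cases hz : v 1 = 0
        · have h0 : v 0 ≠ 0 := by tauto
          simp only [hz, mul_zero, add_zero]
          positivity
        · have : 0 < (A 0 0 * A 1 1 - A 0 1 ^ 2) * v 1 ^ 2 := by positivity
          linarith [sq_nonneg (A 0 0 * v 0 + A 0 1 * v 1)]
      exact (pos_iff_pos_of_mul_pos key).1 h1

lemma Matrix.trace_inv_fin_two (A : Matrix (Fin 2) (Fin 2) ℝ) :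
    (A⁻¹).trace = (A 0 0 + A 1 1) / (A 0 0 * A 1 1 - A 0 1 * A 1 0) := by
  rw [Matrix.inv_def, Matrix.adjugate_fin_two, Matrix.trace_smul, Matrix.trace_fin_two_of,
    Matrix.det_fin_two, Ring.inverse_eq_inv', smul_eq_mul, div_eq_inv_mul, add_comm (A 1 1)]

/-- Monotonicity of positive definiteness and of `A ↦ tr A⁻¹` in the Loewner order, for real
symmetric `2 × 2` matrices given by their entries `(α, γ, δ)`. -/
lemma trace_div_det_antitone {α γ δ a c b : ℝ} (hα : 0 < α) (hdet : 0 < α * δ - γ ^ 2)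
    (hD : ∀ s t : ℝ, 0 ≤ a * s ^ 2 + 2 * c * s * t + b * t ^ 2) :
    0 < α + a ∧ 0 < (α + a) * (δ + b) - (γ + c) ^ 2 ∧
      (α + a + (δ + b)) / ((α + a) * (δ + b) - (γ + c) ^ 2) ≤ (α + δ) / (α * δ - γ ^ 2) := by
  have ha : 0 ≤ a := by simpa using hD 1 0
  have hb : 0 ≤ b := by simpa using hD 0 1
  have hδ : 0 < δ := by
    by_contra! h
    nlinarith [sq_nonneg γ, mul_nonneg hα.le (neg_nonneg.2 h)]
  have hab : 0 ≤ a * b - c ^ 2 := by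
    rcases hb.eq_or_lt with h | h
    · have h0 : c = 0 := by
        by_contra hc
        have := hD 1 (-(a + 1) / (2 * c))
        rw [← h] at this
        have e : 2 * c * 1 * (-(a + 1) / (2 * c)) = -(a + 1) := by field_simp
        rw [e] at this
        linarith
      simp [← h, h0]
    · have := hD b (-c)
      have : 0 ≤ b * (a * b - c ^ 2) := by nlinarith
      exact nonneg_of_mul_nonneg_right this h
  -- the mixed discriminant is nonnegative
  have hmix : 0 ≤ α * b + a * δ - 2 * γ * c := by
    have := hD γ (-α)
    have h2 : 0 ≤ α * (α * b + a * δ - 2 * γ * c) := by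
      nlinarith [mul_nonneg ha hdet.le]
    exact nonneg_of_mul_nonneg_right h2 hα
  have hdet' : 0 < (α + a) * (δ + b) - (γ + c) ^ 2 := by nlinarith
  refine ⟨by linarith, hdet', ?_⟩
  rw [div_le_div_iff₀ hdet' hdet]
  have h1 := hD γ (-α)
  have h2 := hD δ (-γ)
  nlinarith [mul_nonneg (add_pos hα hδ).le hab]

namespace ISACNetwork

variable {M K N Nt : ℕ} (S : ISACNetwork M K N Nt)

/-! ### Gains, powers and interferences as quadratic forms -/

/-- The linear map `f ↦ a(θ_m)ᵀ f_{m,k}`. -/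
def steerMap (m : Fin M) (k : Fin K) : Beamformers M K Nt →L[ℝ] ℂ where
  toFun f := S.steer m (f m k)
  map_add' f g := by simp [steer, mul_add, Finset.sum_add_distrib]
  map_smul' t f := by simp [steer, Finset.mul_sum, mul_left_comm]
  cont := by unfold steer; fun_prop

/-- The linear map `f ↦ h_{i,m,k}ᴴ f_{i,j}` for `p = (i, j)`. -/
def channelMap (m : Fin M) (k : Fin K) (p : Fin M × Fin K) : Beamformers M K Nt →L[ℝ] ℂ where
  toFun f := inner ℂ (S.h p.1 m k) (f p.1 p.2)
  map_add' f g := by simp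
  map_smul' t f := by simp [inner_smul_right_eq_smul]
  cont := by fun_prop

/-- The coordinates of the beamformers of base station `m`. -/
def coordMap (m : Fin M) (p : Fin K × Fin Nt) : Beamformers M K Nt →L[ℝ] ℂ where
  toFun f := f m p.1 p.2
  map_add' f g := by simp
  map_smul' t f := by simp
  cont := by fun_prop

lemma steerMap_apply (m : Fin M) (k : Fin K) (f : Beamformers M K Nt) :
    S.steerMap m k f = S.steer m (f m k) := rfl

lemma channelMap_apply (m : Fin M) (k : Fin K) (p : Fin M × Fin K) (f : Beamformers M K Nt) :
    S.channelMap m k p f = inner ℂ (S.h p.1 m k) (f p.1 p.2) := rfl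

lemma coordMap_apply (m : Fin M) (p : Fin K × Fin Nt) (f : Beamformers M K Nt) :
    coordMap m p f = f m p.1 p.2 := rfl

/-- The received power `|h_{m,m,k}ᴴ f_{m,k}|²` of the useful signal. -/
def signal (f : Beamformers M K Nt) (m : Fin M) (k : Fin K) : ℝ :=
  ‖inner ℂ (S.h m m k) (f m k)‖ ^ 2

lemma interference_eq_quadForm (f : Beamformers M K Nt) (m : Fin M) (k : Fin K) :
    S.interference f m k =
      quadForm {p : Fin M × Fin K | p ≠ (m, k)} (S.channelMap m k) f := rfl

lemma signal_eq_quadForm (f : Beamformers M K Nt) (m : Fin M) (k : Fin K) :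
    S.signal f m k = quadForm {(m, k)} (S.channelMap m k) f := by
  simp [signal, quadForm, channelMap_apply]

lemma power_eq_quadForm (f : Beamformers M K Nt) (m : Fin M) :
    power f m = quadForm Finset.univ (coordMap m) f := by
  simp [power, quadForm, coordMap_apply, Fintype.sum_prod_type, EuclideanSpace.norm_sq_eq]

/-- The polar form of `f ↦ S.gain f m`. -/
def gainPolar (m : Fin M) (f : Beamformers M K Nt) : Beamformers M K Nt →L[ℝ] ℝ :=
  polarForm Finset.univ (S.steerMap m) f

/-- The polar form of `f ↦ S.signal f m k`. -/
def signalPolar (m : Fin M) (k : Fin K) (f : Beamformers M K Nt) : Beamformers M K Nt →L[ℝ] ℝ :=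
  polarForm {(m, k)} (S.channelMap m k) f

/-- The polar form of `f ↦ S.interference f m k`. -/
def interferencePolar (m : Fin M) (k : Fin K) (f : Beamformers M K Nt) :
    Beamformers M K Nt →L[ℝ] ℝ :=
  polarForm {p : Fin M × Fin K | p ≠ (m, k)} (S.channelMap m k) f

lemma gainPolar_eq (m : Fin M) (f y : Beamformers M K Nt) :
    (∑ k, star (S.steer m (y m k)) * S.steer m (f m k)).re = S.gainPolar m f y := by
  rw [gainPolar, polarForm_comm, polarForm_apply, Complex.re_sum]
  simp only [steerMap_apply]

lemma signalPolar_eq (m : Fin M) (k : Fin K) (f y : Beamformers M K Nt) :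
    (inner ℂ (y m k) (S.h m m k) * inner ℂ (S.h m m k) (f m k)).re = S.signalPolar m k f y := by
  rw [signalPolar, polarForm_comm, polarForm_apply, Finset.sum_singleton,
    channelMap_apply, channelMap_apply, ← inner_conj_symm (y m k)]
  simp only [starRingEnd_apply]

lemma hasFDerivAt_gain (f : Beamformers M K Nt) (m : Fin M) :
    HasFDerivAt (fun f => S.gain f m) ((2 : ℝ) • S.gainPolar m f) f :=
  hasFDerivAt_quadForm Finset.univ (S.steerMap m) f

lemma continuous_gain : Continuous S.gain :=
  continuous_pi fun m => continuous_quadForm _ (S.steerMap m)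

lemma continuous_interference (m : Fin M) (k : Fin K) :
    Continuous fun f => S.interference f m k :=
  continuous_quadForm _ (S.channelMap m k)

lemma continuous_signal (m : Fin M) (k : Fin K) : Continuous fun f => S.signal f m k := by
  simp only [signal_eq_quadForm]; exact continuous_quadForm _ _

lemma continuous_power (m : Fin M) : Continuous fun f : Beamformers M K Nt => power f m := by
  simp only [power_eq_quadForm]; exact continuous_quadForm _ _

lemma interference_nonneg (f : Beamformers M K Nt) (m : Fin M) (k : Fin K) :
    0 ≤ S.interference f m k := quadForm_nonneg _ (S.channelMap m k) f

lemma signal_nonneg (f : Beamformers M K Nt) (m : Fin M) (k : Fin K) : 0 ≤ S.signal f m k :=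
  sq_nonneg _

lemma le_gain_of_tangent {f y : Beamformers M K Nt} {m : Fin M} :
    2 * S.gainPolar m f y - S.gain f m ≤ S.gain y m :=
  tangent_le_quadForm _ (S.steerMap m) f y

lemma le_signal_of_tangent {f y : Beamformers M K Nt} {m : Fin M} {k : Fin K} :
    2 * S.signalPolar m k f y - S.signal f m k ≤ S.signal y m k := by
  simp only [signal_eq_quadForm]
  exact tangent_le_quadForm _ _ f y

lemma gainPolar_self (f : Beamformers M K Nt) (m : Fin M) : S.gainPolar m f f = S.gain f m :=
  polarForm_self _ (S.steerMap m) f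

lemma signalPolar_self (f : Beamformers M K Nt) (m : Fin M) (k : Fin K) :
    S.signalPolar m k f f = S.signal f m k := by
  rw [signal_eq_quadForm]; exact polarForm_self _ _ f

/-! ### The constraints of the sensing-centric problem -/

lemma isCompact_power_le (P : ℝ) : IsCompact {f : Beamformers M K Nt | ∀ m, power f m ≤ P} := by
  refine Metric.isCompact_of_isClosed_isBounded ?_ ?_
  · simp only [Set.ofPred_forall]
    exact isClosed_iInter fun m => isClosed_le (continuous_power m) continuous_const
  · refine (Metric.isBounded_closedBall (x := (0 : Beamformers M K Nt)) (r := √|P|)).subset ?_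
    intro f hf
    rw [mem_closedBall_zero_iff, pi_norm_le_iff_of_nonneg (by positivity)]
    intro m
    rw [pi_norm_le_iff_of_nonneg (by positivity)]
    intro k
    refine Real.le_sqrt_of_sq_le ?_
    calc ‖f m k‖ ^ 2 ≤ power f m :=
          Finset.single_le_sum (f := fun k => ‖f m k‖ ^ 2) (fun _ _ => sq_nonneg _)
            (Finset.mem_univ k)
      _ ≤ P := hf m
      _ ≤ |P| := le_abs_self P

lemma noise_pos (hσn : 0 < S.σn) (f : Beamformers M K Nt) (m : Fin M) (k : Fin K) :
    0 < S.interference f m k + S.σn ^ 2 := by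
  have := S.interference_nonneg f m k; positivity

lemma sinr_eq (f : Beamformers M K Nt) (m : Fin M) (k : Fin K) :
    S.sinr f m k = S.signal f m k / (S.interference f m k + S.σn ^ 2) := rfl

lemma continuous_sinr (hσn : 0 < S.σn) (m : Fin M) (k : Fin K) :
    Continuous fun f => S.sinr f m k := by
  simp only [sinr_eq]
  exact (S.continuous_signal m k).div ((S.continuous_interference m k).add continuous_const)
    fun f => (S.noise_pos hσn f m k).ne'

/-- The derivatives of the constraint functions, the SINR being differentiated as a product of
the signal power and the inverse of the interference plus noise. -/
def constraintDeriv (f : Beamformers M K Nt) :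
    Fin M ⊕ (Fin M × Fin K) → Beamformers M K Nt →L[ℝ] ℝ
  | .inl m => (2 : ℝ) • polarForm Finset.univ (coordMap m) f
  | .inr (m, k) =>
      -(S.signal f m k • (-((S.interference f m k + S.σn ^ 2) ^ 2)⁻¹ •
          ((2 : ℝ) • S.interferencePolar m k f)) +
        (S.interference f m k + S.σn ^ 2)⁻¹ • ((2 : ℝ) • S.signalPolar m k f))

lemma hasFDerivAt_constraint (hσn : 0 < S.σn) (f : Beamformers M K Nt)
    (i : Fin M ⊕ (Fin M × Fin K)) :
    HasFDerivAt (S.constraint i) (S.constraintDeriv f i) f := by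
  match i with
  | .inl m =>
    simp only [constraint, constraintDeriv, power_eq_quadForm]
    exact (hasFDerivAt_quadForm _ _ f).sub_const _
  | .inr (m, k) =>
    simp only [constraint, constraintDeriv, sinr_eq, div_eq_mul_inv]
    have hs : HasFDerivAt (fun f => S.signal f m k) ((2 : ℝ) • S.signalPolar m k f) f := by
      simp only [signal_eq_quadForm]; exact hasFDerivAt_quadForm _ _ f
    have hi : HasFDerivAt (fun f => S.interference f m k + S.σn ^ 2)
        ((2 : ℝ) • S.interferencePolar m k f) f :=
      (hasFDerivAt_quadForm _ (S.channelMap m k) f).add_const _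
    exact (hs.mul ((hasDerivAt_inv (S.noise_pos hσn f m k).ne').comp_hasFDerivAt f hi)).const_sub _

/-- At a point where the SINR constraint is active its derivative is a positive multiple of
`η W' - A'`, `A` and `W` being the signal power and the interference plus noise. -/
lemma constraintDeriv_inr_neg_iff (hσn : 0 < S.σn) {f d : Beamformers M K Nt} {m : Fin M}
    {k : Fin K} (hact : S.signal f m k = S.η * (S.interference f m k + S.σn ^ 2)) :
    S.constraintDeriv f (.inr (m, k)) d < 0 ↔
      S.η * S.interferencePolar m k f d < S.signalPolar m k f d := by
  have hW := S.noise_pos hσn f m k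
  set W := S.interference f m k + S.σn ^ 2
  have e : S.constraintDeriv f (.inr (m, k)) d =
      (2 * W⁻¹) * (S.η * S.interferencePolar m k f d - S.signalPolar m k f d) := by
    simp only [constraintDeriv, _root_.neg_apply, _root_.smul_apply, _root_.add_apply,
      smul_eq_mul, hact]
    change -(S.η * W * (-(W ^ 2)⁻¹ * (2 * _)) + W⁻¹ * (2 * _)) = _
    field_simp
    ring
  have h2 : 0 < 2 * W⁻¹ := by positivity
  rw [e, ← sub_neg (b := S.signalPolar m k f d)]
  exact ⟨fun h => neg_of_mul_neg_right h h2.le, fun h => mul_neg_of_pos_of_neg h2 h⟩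

/-! ### The Cramér-Rao bound as a function of the gains -/

lemma info_apply (q : Fin M → ℝ) (i j : Fin 2) :
    S.info q i j = ∑ p : Fin M × Fin N, q p.1 *
      ((8 * Real.pi ^ 2 * S.T * S.β ^ 2 / S.σs ^ 2 * ‖S.ε p.1 p.2‖ ^ 2) *
        (S.Lam i p * S.Lam j p)) := by
  rw [info, Zhat, Matrix.mul_apply]
  refine Finset.sum_congr rfl fun p _ => ?_
  rw [Matrix.mul_diagonal, Matrix.transpose_apply]
  ring

lemma info_symm (q : Fin M → ℝ) : S.info q 1 0 = S.info q 0 1 := by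
  simp only [info_apply, mul_comm (S.Lam 1 _)]

/-- The determinant of the (symmetric) information matrix. -/
def infoDet (q : Fin M → ℝ) : ℝ := S.info q 0 0 * S.info q 1 1 - S.info q 0 1 ^ 2

lemma posDef_iff {q : Fin M → ℝ} : (S.info q).PosDef ↔ 0 < S.info q 0 0 ∧ 0 < S.infoDet q :=
  Matrix.posDef_fin_two_iff (S.info_symm q)

lemma traceInv_eq (q : Fin M → ℝ) :
    S.traceInv q = (S.info q 0 0 + S.info q 1 1) / S.infoDet q := by
  rw [traceInv, Matrix.trace_inv_fin_two, info_symm, infoDet, sq]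

@[fun_prop]
lemma differentiable_info (i j : Fin 2) : Differentiable ℝ fun q => S.info q i j := by
  simp only [info_apply]; fun_prop

@[fun_prop]
lemma continuous_info (i j : Fin 2) : Continuous fun q => S.info q i j :=
  (S.differentiable_info i j).continuous

@[fun_prop]
lemma differentiable_infoDet : Differentiable ℝ S.infoDet := by
  unfold infoDet; fun_prop

@[fun_prop]
lemma continuous_infoDet : Continuous S.infoDet := S.differentiable_infoDet.continuous

lemma differentiableAt_traceInv {q : Fin M → ℝ} (h : (S.info q).PosDef) :
    DifferentiableAt ℝ S.traceInv q := by
  have e : S.traceInv = fun q => (S.info q 0 0 + S.info q 1 1) * (S.infoDet q)⁻¹ :=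
    funext S.traceInv_eq
  rw [e]
  have h1 : DifferentiableAt ℝ (fun q => S.info q 0 0 + S.info q 1 1) q := by fun_prop
  exact h1.fun_mul ((S.differentiable_infoDet q).fun_inv (S.posDef_iff.1 h).2.ne')

lemma isOpen_posDef : IsOpen {q | (S.info q).PosDef} := by
  simp only [posDef_iff, Set.ofPred_and]
  exact (isOpen_lt continuous_const (by fun_prop)).inter
    (isOpen_lt continuous_const (by fun_prop))

lemma info_diag_pos {q : Fin M → ℝ} (h : (S.info q).PosDef) (i : Fin 2) : 0 < S.info q i i :=
  h.diag_pos

lemma traceInv_pos {q : Fin M → ℝ} (h : (S.info q).PosDef) : 0 < S.traceInv q := by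
  rw [traceInv_eq]
  exact div_pos (add_pos (S.info_diag_pos h 0) (S.info_diag_pos h 1)) (S.posDef_iff.1 h).2

/-- Larger gains keep the information matrix positive definite and decrease the bound. -/
lemma posDef_and_traceInv_le_of_le (hT : 0 < S.T) {q q' : Fin M → ℝ}
    (h : (S.info q).PosDef) (hqq : ∀ m, q m ≤ q' m) :
    (S.info q').PosDef ∧ S.traceInv q' ≤ S.traceInv q := by
  have hadd : ∀ i j, S.info q' i j = S.info q i j + S.info (q' - q) i j := fun i j => by
    simp only [info_apply, ← Finset.sum_add_distrib, Pi.sub_apply]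
    exact Finset.sum_congr rfl fun p _ => by ring
  have hD : ∀ s t : ℝ, 0 ≤ S.info (q' - q) 0 0 * s ^ 2 + 2 * S.info (q' - q) 0 1 * s * t
      + S.info (q' - q) 1 1 * t ^ 2 := by
    intro s t
    have e : S.info (q' - q) 0 0 * s ^ 2 + 2 * S.info (q' - q) 0 1 * s * t
        + S.info (q' - q) 1 1 * t ^ 2 = ∑ p : Fin M × Fin N, (q' p.1 - q p.1) *
          ((8 * Real.pi ^ 2 * S.T * S.β ^ 2 / S.σs ^ 2 * ‖S.ε p.1 p.2‖ ^ 2) *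
            (S.Lam 0 p * s + S.Lam 1 p * t) ^ 2) := by
      simp only [info_apply, Finset.sum_mul, Finset.mul_sum, ← Finset.sum_add_distrib,
        Pi.sub_apply]
      exact Finset.sum_congr rfl fun p _ => by ring
    rw [e]
    refine Finset.sum_nonneg fun p _ => mul_nonneg (sub_nonneg.2 (hqq _)) ?_
    positivity
  obtain ⟨h1, h2, h3⟩ := trace_div_det_antitone (S.posDef_iff.1 h).1 (S.posDef_iff.1 h).2 hD
  simp only [← hadd] at h1 h2 h3
  rw [posDef_iff, traceInv_eq, traceInv_eq]
  exact ⟨⟨h1, h2⟩, h3⟩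

/-- Sublevel sets of the bound, described by inequalities between continuous functions: the bound
blows up at the boundary of its domain. -/
lemma posDef_and_traceInv_le_iff {q : Fin M → ℝ} {c : ℝ} (hc : 0 < c) :
    (S.info q).PosDef ∧ S.traceInv q ≤ c ↔
      4 ≤ c * (S.info q 0 0 + S.info q 1 1) ∧ S.info q 0 0 + S.info q 1 1 ≤ c * S.infoDet q := by
  constructor
  · rintro ⟨h, hle⟩
    have hdet := (S.posDef_iff.1 h).2
    have h0 := S.info_diag_pos h 0
    have h1 := S.info_diag_pos h 1
    rw [traceInv_eq, div_le_iff₀ hdet] at hle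
    refine ⟨?_, hle⟩
    -- `4 det A ≤ (tr A)²`
    have h4 : 4 * S.infoDet q ≤ (S.info q 0 0 + S.info q 1 1) ^ 2 := by
      unfold infoDet
      nlinarith [sq_nonneg (S.info q 0 0 - S.info q 1 1), sq_nonneg (S.info q 0 1)]
    have h5 : (S.info q 0 0 + S.info q 1 1) * 4 ≤
        (S.info q 0 0 + S.info q 1 1) * (c * (S.info q 0 0 + S.info q 1 1)) := by
      nlinarith [mul_le_mul_of_nonneg_left h4 hc.le]
    exact le_of_mul_le_mul_left h5 (add_pos h0 h1)
  · rintro ⟨h4, hle⟩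
    have htr : 0 < S.info q 0 0 + S.info q 1 1 := pos_of_mul_pos_right (by linarith) hc.le
    have hdet : 0 < S.infoDet q := pos_of_mul_pos_right (htr.trans_le hle) hc.le
    refine ⟨S.posDef_iff.2 ⟨?_, hdet⟩, ?_⟩
    · unfold infoDet at hdet
      by_contra! h0
      nlinarith [sq_nonneg (S.info q 0 1), sq_nonneg (S.info q 0 0)]
    · rwa [traceInv_eq, div_le_iff₀ hdet]

lemma isClosed_traceInv_le {c : ℝ} (hc : 0 < c) :
    IsClosed {q | (S.info q).PosDef ∧ S.traceInv q ≤ c} := by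
  simp only [S.posDef_and_traceInv_le_iff hc, Set.ofPred_and]
  exact (isClosed_le (by fun_prop) (by fun_prop)).inter (isClosed_le (by fun_prop) (by fun_prop))

variable {S}

/-! ### The surrogate problem as an inner approximation -/

lemma ReformFeasible.u_pos (hσn : 0 < S.σn) {x : SCAState M K Nt} {q : Fin M → ℝ}
    (h : S.ReformFeasible x q) (m : Fin M) (k : Fin K) : 0 < x.u m k :=
  (S.noise_pos hσn x.f m k).trans_le (by linarith [h.noise m k])

lemma ReformFeasible.mul_u_le (hσn : 0 < S.σn) {x : SCAState M K Nt} {q : Fin M → ℝ}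
    (h : S.ReformFeasible x q) (m : Fin M) (k : Fin K) : S.η * x.u m k ≤ x.ρ m k ^ 2 :=
  (le_div_iff₀ (h.u_pos hσn m k)).1 (h.ratio m k)

lemma ReformFeasible.with_gain (hT : 0 < S.T) {x : SCAState M K Nt} {q : Fin M → ℝ}
    (h : S.ReformFeasible x q) : S.ReformFeasible x (S.gain x.f) where
  dom := (S.posDef_and_traceInv_le_of_le hT h.dom h.le_gain).1
  power_le := h.power_le
  le_gain _ := le_rfl
  ratio := h.ratio
  signal := h.signal
  noise := h.noise

lemma ReformFeasible.crlb_le (hT : 0 < S.T) {x : SCAState M K Nt} {q : Fin M → ℝ}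
    (h : S.ReformFeasible x q) : S.crlb x.f ≤ S.traceInv q :=
  (S.posDef_and_traceInv_le_of_le hT h.dom h.le_gain).2

lemma ReformFeasible.feasible (hT : 0 < S.T) (hσn : 0 < S.σn) (hη : 0 < S.η)
    {x : SCAState M K Nt} {q : Fin M → ℝ} (h : S.ReformFeasible x q) : S.Feasible x.f := by
  refine ⟨(h.with_gain hT).dom, ?_⟩
  rintro (m | ⟨m, k⟩)
  · exact sub_nonpos.2 (h.power_le m)
  · refine sub_nonpos.2 ?_
    rw [sinr_eq, le_div_iff₀ (S.noise_pos hσn _ _ _), add_comm]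
    exact (mul_le_mul_of_nonneg_left (h.noise m k) hη.le).trans
      ((h.mul_u_le hσn m k).trans (h.signal m k))

/-- The iterate with beamformers `f` and the values of `ρ` and `u` for which the signal and noise
constraints are tight. -/
def tightState (S : ISACNetwork M K N Nt) (f : Beamformers M K Nt) : SCAState M K Nt where
  f := f
  ρ m k := ‖inner ℂ (S.h m m k) (f m k)‖
  u m k := S.σn ^ 2 + S.interference f m k

lemma Feasible.reformFeasible {f : Beamformers M K Nt} (h : S.Feasible f) :
    S.ReformFeasible (S.tightState f) (S.gain f) where
  dom := h.1
  power_le m := sub_nonpos.1 (h.2 (.inl m))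
  le_gain _ := le_rfl
  ratio m k := by
    have := sub_nonpos.1 (h.2 (.inr (m, k)))
    rwa [sinr, add_comm] at this
  signal _ _ := le_rfl
  noise _ _ := le_rfl

lemma ReformFeasible.surrogateFeasible_self (hσn : 0 < S.σn) {x : SCAState M K Nt}
    {q : Fin M → ℝ} (h : S.ReformFeasible x q) : S.SurrogateFeasible x x q where
  dom := h.dom
  power_le := h.power_le
  le_gain m := by
    rw [gainPolar_eq, gainPolar_self]
    linarith [h.le_gain m]
  ratio m k := by
    have hu := h.u_pos hσn m k
    refine (h.ratio m k).trans_eq ?_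
    field_simp
    ring
  signal m k := by
    rw [signalPolar_eq, signalPolar_self, ISACNetwork.signal]
    linarith [h.signal m k]
  noise := h.noise

/-- The surrogate constraints are tighter than the original ones. -/
lemma SurrogateFeasible.reformFeasible (hσn : 0 < S.σn) {x y : SCAState M K Nt} {q : Fin M → ℝ}
    (h : S.SurrogateFeasible x y q) : S.ReformFeasible y q where
  dom := h.dom
  power_le := h.power_le
  le_gain m := by
    have := h.le_gain m
    rw [gainPolar_eq] at this
    exact this.trans S.le_gain_of_tangent
  ratio m k := by
    have hu : 0 < y.u m k :=
      (S.noise_pos hσn y.f m k).trans_le (by linarith [h.noise m k])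
    refine (h.ratio m k).trans ?_
    rw [le_div_iff₀ hu]
    have e : (2 * x.ρ m k / x.u m k * y.ρ m k - x.ρ m k ^ 2 / x.u m k ^ 2 * y.u m k) * y.u m k
        = y.ρ m k ^ 2 - (y.ρ m k - x.ρ m k / x.u m k * y.u m k) ^ 2 := by ring
    rw [e]
    linarith [sq_nonneg (y.ρ m k - x.ρ m k / x.u m k * y.u m k)]
  signal m k := by
    have := h.signal m k
    rw [signalPolar_eq] at this
    exact this.trans S.le_signal_of_tangent
  noise := h.noise

/-! ### Existence of surrogate solutions -/

/-- All admissible points lie in a common compact set. -/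
lemma exists_isCompact_reformFeasible (S : ISACNetwork M K N Nt) (hσn : 0 < S.σn)
    (hη : 0 < S.η) :
    ∃ C : Set (Beamformers M K Nt × (Fin M → Fin K → ℝ) × (Fin M → Fin K → ℝ)), IsCompact C ∧
      ∀ x q, S.ReformFeasible x q → (x.f, x.ρ, x.u) ∈ C := by
  obtain ⟨B, hB⟩ :=
    (isCompact_power_le (M := M) (K := K) (Nt := Nt) S.P).exists_bound_of_continuousOn
    (f := fun f => ∑ m, ∑ k, S.signal f m k)
    (continuous_finsetSum _ fun m _ => continuous_finsetSum _ fun k _ =>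
      S.continuous_signal m k).continuousOn
  refine ⟨{f | ∀ m, power f m ≤ S.P} ×ˢ (Set.Icc (fun _ _ => -(B + 1)) (fun _ _ => B + 1) ×ˢ
    Set.Icc (fun _ _ => 0) (fun _ _ => B / S.η)),
    (isCompact_power_le S.P).prod (isCompact_Icc.prod isCompact_Icc), fun x q h => ?_⟩
  have hρ : ∀ m k, x.ρ m k ^ 2 ≤ B := fun m k => calc
    x.ρ m k ^ 2 ≤ S.signal x.f m k := h.signal m k
    _ ≤ ∑ k, S.signal x.f m k :=
      Finset.single_le_sum (fun k _ => S.signal_nonneg x.f m k) (Finset.mem_univ k)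
    _ ≤ ∑ m, ∑ k, S.signal x.f m k :=
      Finset.single_le_sum (f := fun m => ∑ k, S.signal x.f m k)
        (fun m _ => Finset.sum_nonneg fun k _ => S.signal_nonneg x.f m k) (Finset.mem_univ m)
    _ ≤ B := (le_abs_self _).trans (hB _ h.power_le)
  refine ⟨h.power_le, ⟨fun m k => ?_, fun m k => ?_⟩, fun m k => ?_, fun m k => ?_⟩
  · change -(B + 1) ≤ x.ρ m k
    nlinarith [hρ m k, sq_nonneg (x.ρ m k + 1)]
  · change x.ρ m k ≤ B + 1
    nlinarith [hρ m k, sq_nonneg (x.ρ m k - 1)]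
  · exact (h.u_pos hσn m k).le
  · change x.u m k ≤ B / S.η
    rw [le_div_iff₀ hη, mul_comm]
    exact (h.mul_u_le hσn m k).trans (hρ m k)

/-- The tangents at `f` to the gains, evaluated at `y`: the bounds for `q` in the surrogate
problem. -/
def gainTangent (S : ISACNetwork M K N Nt) (f y : Beamformers M K Nt) (m : Fin M) : ℝ :=
  2 * S.gainPolar m f y - S.gain f m

lemma continuous_gainTangent (f : Beamformers M K Nt) : Continuous (S.gainTangent f) := by
  unfold gainTangent; fun_prop

/-- By monotonicity of the objective, `q` may be taken as large as its constraint allows. -/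
lemma SurrogateFeasible.with_tangent (hT : 0 < S.T) {x y : SCAState M K Nt} {q : Fin M → ℝ}
    (h : S.SurrogateFeasible x y q) :
    S.SurrogateFeasible x y (S.gainTangent x.f y.f) ∧
      S.traceInv (S.gainTangent x.f y.f) ≤ S.traceInv q := by
  have h1 : ∀ m, q m ≤ S.gainTangent x.f y.f m := fun m => by
    have := h.le_gain m
    rwa [gainPolar_eq] at this
  have h2 := S.posDef_and_traceInv_le_of_le hT h.dom h1
  refine ⟨{ h with dom := h2.1, le_gain := fun m => ?_ }, h2.2⟩
  rw [gainPolar_eq, gainTangent]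

lemma isClosed_surrogateFeasible (x : SCAState M K Nt) {c : ℝ} (hc : 0 < c) :
    IsClosed {z : Beamformers M K Nt × (Fin M → Fin K → ℝ) × (Fin M → Fin K → ℝ) |
      S.SurrogateFeasible x ⟨z.1, z.2.1, z.2.2⟩ (S.gainTangent x.f z.1) ∧
        S.traceInv (S.gainTangent x.f z.1) ≤ c} := by
  have e : ∀ z : Beamformers M K Nt × (Fin M → Fin K → ℝ) × (Fin M → Fin K → ℝ),
      (S.SurrogateFeasible x ⟨z.1, z.2.1, z.2.2⟩ (S.gainTangent x.f z.1) ∧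
        S.traceInv (S.gainTangent x.f z.1) ≤ c) ↔
      ((S.info (S.gainTangent x.f z.1)).PosDef ∧ S.traceInv (S.gainTangent x.f z.1) ≤ c) ∧
        (∀ m, power z.1 m ≤ S.P) ∧
        (∀ m k, S.η ≤
          2 * x.ρ m k / x.u m k * z.2.1 m k - x.ρ m k ^ 2 / x.u m k ^ 2 * z.2.2 m k) ∧
        (∀ m k, z.2.1 m k ^ 2 ≤ 2 * S.signalPolar m k x.f z.1 - S.signal x.f m k) ∧
        ∀ m k, S.σn ^ 2 + S.interference z.1 m k ≤ z.2.2 m k := by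
    intro z
    constructor
    · rintro ⟨h, h'⟩
      refine ⟨⟨h.dom, h'⟩, h.power_le, h.ratio, fun m k => ?_, h.noise⟩
      rw [← signalPolar_eq]
      exact h.signal m k
    · rintro ⟨⟨h1, h2⟩, h3, h4, h5, h6⟩
      refine ⟨⟨h1, h3, fun m => ?_, h4, fun m k => ?_, h6⟩, h2⟩
      · rw [gainPolar_eq, gainTangent]
      · rw [signalPolar_eq]
        exact h5 m k
  simp only [e, Set.ofPred_and, Set.ofPred_forall]
  refine ((S.isClosed_traceInv_le hc).preimage
    ((continuous_gainTangent (S := S) x.f).comp continuous_fst)).inter ?_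
  refine (isClosed_iInter fun m =>
    isClosed_le ((continuous_power m).comp continuous_fst) continuous_const).inter ?_
  refine (isClosed_iInter fun m => isClosed_iInter fun k =>
    isClosed_le (by fun_prop) (by fun_prop)).inter ?_
  refine (isClosed_iInter fun m => isClosed_iInter fun k =>
    isClosed_le (by fun_prop) (by fun_prop)).inter ?_
  exact isClosed_iInter fun m => isClosed_iInter fun k => isClosed_le
    (continuous_const.add ((S.continuous_interference m k).comp continuous_fst)) (by fun_prop)

lemma ReformFeasible.exists_isSurrogateSolution (hT : 0 < S.T) (hσn : 0 < S.σn) (hη : 0 < S.η)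
    {x : SCAState M K Nt} {q : Fin M → ℝ} (hx : S.ReformFeasible x q) :
    ∃ y, S.IsSurrogateSolution x y := by
  obtain ⟨C, hC, hmem⟩ := S.exists_isCompact_reformFeasible hσn hη
  obtain ⟨hx0, -⟩ := (hx.surrogateFeasible_self hσn).with_tangent hT
  have hD := isClosed_surrogateFeasible (S := S) x (S.traceInv_pos hx0.dom)
  set D := {z : Beamformers M K Nt × (Fin M → Fin K → ℝ) × (Fin M → Fin K → ℝ) |
      S.SurrogateFeasible x ⟨z.1, z.2.1, z.2.2⟩ (S.gainTangent x.f z.1) ∧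
        S.traceInv (S.gainTangent x.f z.1) ≤ S.traceInv (S.gainTangent x.f x.f)}
  have hDc : IsCompact D := hC.of_isClosed_subset hD fun z hz =>
    hmem ⟨z.1, z.2.1, z.2.2⟩ _ (hz.1.reformFeasible hσn)
  have hne : D.Nonempty := ⟨(x.f, x.ρ, x.u), hx0, le_rfl⟩
  have hℓ : Continuous fun z : Beamformers M K Nt × (Fin M → Fin K → ℝ) × (Fin M → Fin K → ℝ) =>
      S.gainTangent x.f z.1 := (continuous_gainTangent x.f).comp continuous_fst
  have hcont : ContinuousOn (fun z => S.traceInv (S.gainTangent x.f z.1)) D := fun z hz =>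
    ((S.differentiableAt_traceInv hz.1.dom).continuousAt.comp_of_eq
      hℓ.continuousAt rfl).continuousWithinAt
  obtain ⟨z, hz, hmin⟩ := hDc.exists_isMinOn hne hcont
  refine ⟨⟨z.1, z.2.1, z.2.2⟩, S.gainTangent x.f z.1, hz.1, fun y' q' h' => ?_⟩
  obtain ⟨h1, h2⟩ := h'.with_tangent hT
  refine le_trans ?_ h2
  rcases le_total (S.traceInv (S.gainTangent x.f y'.f)) (S.traceInv (S.gainTangent x.f x.f))
    with h | h
  · exact isMinOn_iff.1 hmin (y'.f, y'.ρ, y'.u) ⟨h1, h⟩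
  · exact hz.2.trans h

/-! ### Descent at points that are not KKT -/

/-- Points satisfying strictly those surrogate constraints that depend on the current iterate
`x`. -/
structure StrictlySurrogateFeasible (S : ISACNetwork M K N Nt) (x y : SCAState M K Nt)
    (q : Fin M → ℝ) : Prop where
  dom : (S.info q).PosDef
  power_le : ∀ m, power y.f m ≤ S.P
  lt_gain : ∀ m, q m < 2 * S.gainPolar m x.f y.f - S.gain x.f m
  ratio : ∀ m k, S.η <
    2 * x.ρ m k / x.u m k * y.ρ m k - x.ρ m k ^ 2 / x.u m k ^ 2 * y.u m k
  signal : ∀ m k, y.ρ m k ^ 2 < 2 * S.signalPolar m k x.f y.f - S.signal x.f m k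
  noise : ∀ m k, S.σn ^ 2 + S.interference y.f m k ≤ y.u m k

/-- A strictly feasible point of the surrogate problem at `x` stays feasible for the surrogate
problems at the points near `x`. -/
lemma StrictlySurrogateFeasible.eventually {α : Type*} {l : Filter α} {x y : SCAState M K Nt}
    {q : Fin M → ℝ} (h : S.StrictlySurrogateFeasible x y q) {z : α → SCAState M K Nt}
    (hf : Tendsto (fun r => (z r).f) l (𝓝 x.f)) (hρ : Tendsto (fun r => (z r).ρ) l (𝓝 x.ρ))
    (hu : Tendsto (fun r => (z r).u) l (𝓝 x.u)) (hx : ∀ m k, 0 < x.u m k) :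
    ∀ᶠ r in l, S.SurrogateFeasible (z r) y q := by
  have hρ' : ∀ m k, Tendsto (fun r => (z r).ρ m k) l (𝓝 (x.ρ m k)) := fun m k =>
    tendsto_pi_nhds.1 (tendsto_pi_nhds.1 hρ m) k
  have hu' : ∀ m k, Tendsto (fun r => (z r).u m k) l (𝓝 (x.u m k)) := fun m k =>
    tendsto_pi_nhds.1 (tendsto_pi_nhds.1 hu m) k
  have h1 : ∀ᶠ r in l, ∀ m, q m < 2 * S.gainPolar m (z r).f y.f - S.gain (z r).f m := by
    refine eventually_all.2 fun m => Tendsto.eventually_const_lt (h.lt_gain m) ?_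
    exact ((Filter.Tendsto.polarForm _ _ hf tendsto_const_nhds).const_mul 2).sub
      ((tendsto_pi_nhds.1 (S.continuous_gain.tendsto _) m).comp hf)
  have h2 : ∀ᶠ r in l, ∀ m k, S.η < 2 * (z r).ρ m k / (z r).u m k * y.ρ m k -
      (z r).ρ m k ^ 2 / (z r).u m k ^ 2 * y.u m k := by
    refine eventually_all.2 fun m => eventually_all.2 fun k =>
      Tendsto.eventually_const_lt (h.ratio m k) ?_
    exact (((((hρ' m k).const_mul 2).div (hu' m k) (hx m k).ne').mul_const _).sub
      ((((hρ' m k).pow 2).div ((hu' m k).pow 2) (pow_ne_zero 2 (hx m k).ne')).mul_const _))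
  have h3 : ∀ᶠ r in l, ∀ m k, y.ρ m k ^ 2 <
      2 * S.signalPolar m k (z r).f y.f - S.signal (z r).f m k := by
    refine eventually_all.2 fun m => eventually_all.2 fun k =>
      Tendsto.eventually_const_lt (h.signal m k) ?_
    exact ((Filter.Tendsto.polarForm _ _ hf tendsto_const_nhds).const_mul 2).sub
      (((S.continuous_signal m k).tendsto _).comp hf)
  filter_upwards [h1, h2, h3] with r h1 h2 h3
  refine ⟨h.dom, h.power_le, fun m => ?_, fun m k => (h2 m k).le, fun m k => ?_, h.noise⟩
  · rw [gainPolar_eq]; exact (h1 m).le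
  · rw [signalPolar_eq]; exact (h3 m k).le

/-- A feasible point forces a positive power budget and at least one user per base station. -/
lemma Feasible.nonempty_and_power_pos (hσn : 0 < S.σn) (hη : 0 < S.η) {f : Beamformers M K Nt}
    (h : S.Feasible f) : Nonempty (Fin K) ∧ (Nonempty (Fin M) → 0 < S.P) := by
  have hK : Nonempty (Fin K) := by
    by_contra hK
    rw [not_nonempty_iff] at hK
    have h0 := (S.posDef_iff.1 h.1).1
    simp [info_apply, gain] at h0
  refine ⟨hK, fun ⟨m⟩ => ?_⟩
  obtain ⟨k⟩ := hK
  have h1 : S.η ≤ S.sinr f m k := sub_nonpos.1 (h.2 (.inr (m, k)))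
  have h2 : power f m ≤ S.P := sub_nonpos.1 (h.2 (.inl m))
  rw [sinr_eq, le_div_iff₀ (S.noise_pos hσn f m k)] at h1
  have h3 : 0 < S.signal f m k := (mul_pos hη (S.noise_pos hσn f m k)).trans_le h1
  have h4 : f m k ≠ 0 := by
    intro h0
    simp [signal, h0] at h3
  calc 0 < ‖f m k‖ ^ 2 := by positivity
    _ ≤ power f m := Finset.single_le_sum (f := fun k => ‖f m k‖ ^ 2) (fun _ _ => sq_nonneg _)
        (Finset.mem_univ k)
    _ ≤ S.P := h2

/-- Shrinking a strictly SINR-feasible point slightly makes the power constraints strict too. -/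
lemma exists_strictly_feasible (hσn : 0 < S.σn) (hP : Nonempty (Fin M) → 0 < S.P)
    (hslater : ∃ f : Beamformers M K Nt, (∀ m, power f m ≤ S.P) ∧ ∀ m k, S.η < S.sinr f m k) :
    ∃ f : Beamformers M K Nt, (∀ m, power f m < S.P) ∧ ∀ m k, S.η < S.sinr f m k := by
  obtain ⟨f, hpow, hsinr⟩ := hslater
  have h1 : ∀ᶠ s : ℝ in 𝓝[<] 1, ∀ m k, S.η < S.sinr (s • f) m k := by
    refine eventually_all.2 fun m => eventually_all.2 fun k => ?_
    have hc : Continuous fun s : ℝ => S.sinr (s • f) m k :=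
      (S.continuous_sinr hσn m k).comp (continuous_id.smul continuous_const)
    have := (hc.tendsto 1).mono_left (nhdsWithin_le_nhds (s := Set.Iio 1))
    rw [one_smul] at this
    exact this.eventually_const_lt (hsinr m k)
  obtain ⟨s, hs, hs0, hs1⟩ := (h1.and (Ioo_mem_nhdsLT (zero_lt_one (α := ℝ)))).exists
  refine ⟨s • f, fun m => ?_, hs⟩
  rw [power_eq_quadForm, quadForm_smul, ← power_eq_quadForm]
  have hs2 : s ^ 2 < 1 := by nlinarith
  calc s ^ 2 * power f m ≤ s ^ 2 * S.P := mul_le_mul_of_nonneg_left (hpow m) (sq_nonneg s)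
    _ < S.P := by nlinarith [hP ⟨m⟩]

/-- The Mangasarian-Fromovitz condition at every feasible point. The direction points to the
strictly feasible point, after each of its beams has been rotated so that the useful signals
have the same phases as those of `f`; rotations change neither powers nor SINRs. -/
lemma Feasible.exists_constraintDeriv_neg (hσn : 0 < S.σn) (hη : 0 < S.η)
    (hslater : ∃ f : Beamformers M K Nt, (∀ m, power f m ≤ S.P) ∧ ∀ m k, S.η < S.sinr f m k)
    {f : Beamformers M K Nt} (h : S.Feasible f) :
    ∃ d, ∀ i, S.constraint i f = 0 → S.constraintDeriv f i d < 0 := by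
  obtain ⟨g, hgp, hgs⟩ :=
    exists_strictly_feasible hσn (h.nonempty_and_power_pos hσn hη).2 hslater
  have hsf : ∀ m k, 0 < S.signal f m k := fun m k => by
    have h1 : S.η ≤ S.sinr f m k := sub_nonpos.1 (h.2 (.inr (m, k)))
    rw [sinr_eq, le_div_iff₀ (S.noise_pos hσn f m k)] at h1
    exact (mul_pos hη (S.noise_pos hσn f m k)).trans_le h1
  have hsg' : ∀ m k, S.η * (S.interference g m k + S.σn ^ 2) < S.signal g m k := fun m k => by
    have h1 := hgs m k
    rwa [sinr_eq, lt_div_iff₀ (S.noise_pos hσn g m k)] at h1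
  have hne : ∀ f : Beamformers M K Nt, ∀ m k, 0 < S.signal f m k →
      inner ℂ (S.h m m k) (f m k) ≠ 0 := by
    intro f m k h0 h1
    simp [signal, h1] at h0
  choose c hc hre using fun m k => Complex.exists_norm_eq_one_re_conj_mul _ _
    (hne f m k (hsf m k)) (hne g m k ((mul_pos hη (S.noise_pos hσn g m k)).trans (hsg' m k)))
  let g' : Beamformers M K Nt := fun m k => c m k • g m k
  have hpow : ∀ m, power g' m = power g m := fun m => by simp [power, g', norm_smul, hc]
  have hint : ∀ m k, S.interference g' m k = S.interference g m k := fun m k => by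
    simp [interference, g', hc]
  refine ⟨g' - f, ?_⟩
  rintro (m | ⟨m, k⟩) hact
  · have h1 := tangent_le_quadForm Finset.univ (coordMap m) f g'
    have h2 := polarForm_self Finset.univ (coordMap m) f
    rw [← power_eq_quadForm, ← power_eq_quadForm, hpow] at h1
    rw [← power_eq_quadForm] at h2
    have h3 : power f m = S.P := sub_eq_zero.1 hact
    have h4 := hgp m
    simp only [constraintDeriv, _root_.smul_apply, map_sub, smul_eq_mul]
    linarith
  · have h1 : S.η = S.sinr f m k := sub_eq_zero.1 hact
    have hW := S.noise_pos hσn f m k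
    rw [sinr_eq, eq_div_iff hW.ne'] at h1
    rw [S.constraintDeriv_inr_neg_iff hσn h1.symm, map_sub, map_sub, signalPolar_self]
    have hself : S.interferencePolar m k f f = S.interference f m k :=
      polarForm_self _ (S.channelMap m k) f
    rw [hself]
    set a := ‖inner ℂ (S.h m m k) (f m k)‖ with ha
    set b := ‖inner ℂ (S.h m m k) (g m k)‖ with hb
    have ha0 : 0 < a := norm_pos_iff.2 (hne f m k (hsf m k))
    have hb0 : 0 < b := norm_pos_iff.2
      (hne g m k ((mul_pos hη (S.noise_pos hσn g m k)).trans (hsg' m k)))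
    have hab : S.signalPolar m k f g' = a * b := by
      rw [signalPolar, polarForm_apply, Finset.sum_singleton, channelMap_apply, channelMap_apply,
        ha, hb, ← hre m k]
      simp only [g', inner_smul_right]
    have hsa : S.signal f m k = a ^ 2 := rfl
    have hsb : S.signal g m k = b ^ 2 := rfl
    -- Young's inequality with the weight `b / a` that is sharp for the signal term
    have hy := two_mul_polarForm_le {p : Fin M × Fin K | p ≠ (m, k)} (S.channelMap m k) f g'
      (div_pos hb0 ha0)
    rw [← interference_eq_quadForm, ← interference_eq_quadForm, hint, inv_div] at hy
    change 2 * S.interferencePolar m k f g' ≤ _ at hy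
    have hg := hsg' m k
    rw [hab, hsa]
    rw [hsa] at h1
    rw [hsb] at hg
    have hamgm : 2 * S.σn ^ 2 ≤ b / a * S.σn ^ 2 + a / b * S.σn ^ 2 := by
      have : b / a * S.σn ^ 2 + a / b * S.σn ^ 2 - 2 * S.σn ^ 2 =
          S.σn ^ 2 * (a - b) ^ 2 / (a * b) := by field_simp; ring
      have h0 : 0 ≤ S.σn ^ 2 * (a - b) ^ 2 / (a * b) := by positivity
      linarith
    have e1 : b / a * (S.η * (S.interference f m k + S.σn ^ 2)) = a * b := by
      rw [h1]; field_simp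
    have e2 : a / b * (S.η * (S.interference g m k + S.σn ^ 2)) < a * b := by
      have := mul_lt_mul_of_pos_left hg (div_pos ha0 hb0)
      have e : a / b * b ^ 2 = a * b := by field_simp
      rwa [e] at this
    nlinarith [mul_le_mul_of_nonneg_left (add_le_add hy hamgm) hη.le]

/-- At an admissible point whose beamformers are not a KKT point, the surrogate problem has a
strictly feasible point with a smaller value than the current bound. -/
lemma ReformFeasible.exists_strictly_better (hT : 0 < S.T) (hσn : 0 < S.σn) (hη : 0 < S.η)
    (hslater : ∃ f : Beamformers M K Nt, (∀ m, power f m ≤ S.P) ∧ ∀ m k, S.η < S.sinr f m k)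
    {x : SCAState M K Nt} {q : Fin M → ℝ} (hx : S.ReformFeasible x q)
    (hkkt : ¬ S.IsKKTPoint x.f) :
    ∃ y q', S.StrictlySurrogateFeasible x y q' ∧ S.traceInv q' < S.crlb x.f := by
  have hfeas := hx.feasible hT hσn hη
  let f := x.f
  obtain ⟨d₀, hd₀⟩ := hfeas.exists_constraintDeriv_neg hσn hη hslater
  have hgain : HasFDerivAt S.gain
      (ContinuousLinearMap.pi fun m => (2 : ℝ) • S.gainPolar m f) f :=
    hasFDerivAt_pi.2 fun m => S.hasFDerivAt_gain f m
  have hφ := (S.differentiableAt_traceInv hfeas.1).hasFDerivAt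
  set φ' := fderiv ℝ S.traceInv (S.gain x.f)
  have hcrlb : HasFDerivAt S.crlb
      (φ'.comp (ContinuousLinearMap.pi fun m => (2 : ℝ) • S.gainPolar m f)) f :=
    HasFDerivAt.comp f hφ hgain
  obtain ⟨d, hd, hdc⟩ : ∃ d,
      φ'.comp (ContinuousLinearMap.pi fun m => (2 : ℝ) • S.gainPolar m f) d < 0 ∧
      ∀ i, S.constraint i f = 0 → S.constraintDeriv f i d < 0 := by
    by_contra hno
    exact hkkt ⟨hfeas.1, isKKT_of_no_descent hfeas.2 hcrlb
      (fun i => S.hasFDerivAt_constraint hσn f i) hd₀ hno⟩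
  have hρ0 : ∀ m k, x.ρ m k ≠ 0 := fun m k h0 => by
    have := hx.mul_u_le hσn m k
    rw [h0] at this
    have := mul_pos hη (hx.u_pos hσn m k)
    linarith
  have hslopes : ∀ m k, ∃ z u : ℝ,
      (x.u m k - (S.σn ^ 2 + S.interference f m k) = 0 → 2 * S.interferencePolar m k f d < u) ∧
      (S.signal f m k - x.ρ m k ^ 2 = 0 → z < 2 * S.signalPolar m k f d) ∧
      (x.ρ m k ^ 2 / x.u m k - S.η = 0 → S.η * u < z) := fun m k => by
    refine exists_intermediate_slopes hη fun h1 h2 h3 => ?_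
    have hu := hx.u_pos hσn m k
    rw [sub_eq_zero, div_eq_iff hu.ne'] at h3
    have h4 : S.signal f m k = S.η * (S.interference f m k + S.σn ^ 2) := by
      rw [sub_eq_zero.1 h2, h3, sub_eq_zero.1 h1, add_comm]
    have h5 := hdc (.inr (m, k)) (by
      change S.η - S.sinr f m k = 0
      rw [sinr_eq, h4, mul_div_cancel_right₀ _ (S.noise_pos hσn f m k).ne', sub_self])
    rw [S.constraintDeriv_inr_neg_iff hσn h4] at h5
    linarith
  choose z u' hu' hz hzu using hslopes
  -- `ρ` moves at the speed for which `ρ²` has slope `z`; the term `- t ^ 2` in `Q` makes the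
  -- constraints on `q` strict without changing the derivative of `Q` at `0`
  let y : ℝ → SCAState M K Nt := fun t =>
    { f := f + t • d
      ρ := fun m k => x.ρ m k + t * (z m k / (2 * x.ρ m k))
      u := fun m k => x.u m k + t * u' m k }
  let Q : ℝ → Fin M → ℝ := fun t m => S.gain f m + t * (2 * S.gainPolar m f d) - t ^ 2
  have hQ0 : Q 0 = S.gain f := by funext m; simp [Q]
  have hQ : HasDerivAt Q (fun m => 2 * S.gainPolar m f d) 0 := by
    refine hasDerivAt_pi.2 fun m => ?_
    have := (((hasDerivAt_id (0 : ℝ)).mul_const (2 * S.gainPolar m f d)).const_add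
      (S.gain f m)).sub ((hasDerivAt_id (0 : ℝ)).pow 2)
    convert! this using 1
    simp
  have e1 : ∀ᶠ t in 𝓝[>] (0 : ℝ), S.traceInv (Q t) < S.crlb x.f := by
    have hφ0 : HasFDerivAt S.traceInv φ' (Q 0) := by rw [hQ0]; exact hφ
    have h1 := (hφ0.comp_hasDerivAt 0 hQ).eventually_lt_of_neg hd
    simp only [Function.comp, hQ0] at h1
    exact h1
  have e2 : ∀ᶠ t in 𝓝[>] (0 : ℝ), (S.info (Q t)).PosDef := by
    have h1 : ∀ᶠ q in 𝓝 (Q 0), (S.info q).PosDef :=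
      S.isOpen_posDef.mem_nhds (by rw [hQ0]; exact hfeas.1)
    exact (hQ.continuousAt.mono_left nhdsWithin_le_nhds).eventually h1
  have e3 : ∀ᶠ t in 𝓝[>] (0 : ℝ), ∀ m, power (y t).f m ≤ S.P := by
    refine eventually_all.2 fun m => ?_
    have h1 := eventually_pos_of_quadratic (a := S.P - power f m)
      (b := -(2 * polarForm Finset.univ (coordMap m) f d))
      (c := -quadForm Finset.univ (coordMap m) d) (sub_nonneg.2 (hx.power_le m)) fun h0 => by
        have h2 := hdc (.inl m) (by change power f m - S.P = 0; linarith)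
        simpa [constraintDeriv] using h2
    filter_upwards [h1] with t ht
    simp only [y, power_eq_quadForm, quadForm_add_smul] at ht ⊢
    linarith
  have e4 : ∀ᶠ t in 𝓝[>] (0 : ℝ), ∀ m k, S.η < 2 * x.ρ m k / x.u m k * (y t).ρ m k -
      x.ρ m k ^ 2 / x.u m k ^ 2 * (y t).u m k := by
    refine eventually_all.2 fun m => eventually_all.2 fun k => ?_
    have hu := hx.u_pos hσn m k
    have h1 := eventually_pos_of_quadratic (a := x.ρ m k ^ 2 / x.u m k - S.η)
      (b := (z m k - x.ρ m k ^ 2 / x.u m k * u' m k) / x.u m k) (c := 0)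
      (sub_nonneg.2 (hx.ratio m k)) fun h0 => by
        rw [sub_eq_zero.1 h0]
        exact div_pos (sub_pos.2 (hzu m k h0)) hu
    filter_upwards [h1] with t ht
    rw [← sub_pos]
    convert! ht using 1
    simp only [y]
    have := hρ0 m k
    field_simp
    ring
  have e5 : ∀ᶠ t in 𝓝[>] (0 : ℝ), ∀ m k, (y t).ρ m k ^ 2 <
      2 * S.signalPolar m k x.f (y t).f - S.signal x.f m k := by
    refine eventually_all.2 fun m => eventually_all.2 fun k => ?_
    have h1 := eventually_pos_of_quadratic (a := S.signal f m k - x.ρ m k ^ 2)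
      (b := 2 * S.signalPolar m k f d - z m k) (c := -(z m k / (2 * x.ρ m k)) ^ 2)
      (sub_nonneg.2 (hx.signal m k)) fun h0 => sub_pos.2 (hz m k h0)
    filter_upwards [h1] with t ht
    rw [← sub_pos]
    convert! ht using 1
    simp only [y, map_add, map_smul, smul_eq_mul, f, signalPolar_self]
    have := hρ0 m k
    field_simp
    ring
  have e6 : ∀ᶠ t in 𝓝[>] (0 : ℝ), ∀ m k,
      S.σn ^ 2 + S.interference (y t).f m k ≤ (y t).u m k := by
    refine eventually_all.2 fun m => eventually_all.2 fun k => ?_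
    have h1 := eventually_pos_of_quadratic (a := x.u m k - (S.σn ^ 2 + S.interference f m k))
      (b := u' m k - 2 * S.interferencePolar m k f d) (c := -S.interference d m k)
      (sub_nonneg.2 (hx.noise m k)) fun h0 => sub_pos.2 (hu' m k h0)
    filter_upwards [h1] with t ht
    simp only [y, interference_eq_quadForm, interferencePolar, quadForm_add_smul] at ht ⊢
    linarith
  obtain ⟨t, ht1, ht2, ht3, ht4, ht5, ht6, ht0⟩ :=
    (e1.and (e2.and (e3.and (e4.and (e5.and (e6.and self_mem_nhdsWithin)))))).exists
  refine ⟨y t, Q t, ⟨ht2, ht3, fun m => ?_, ht4, ht5, ht6⟩, ht1⟩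
  have ht0' : (0 : ℝ) < t := ht0
  simp only [y, Q, map_add, map_smul, smul_eq_mul, f, gainPolar_self]
  nlinarith [sq_pos_of_pos ht0']


/-! ### Convergence of the runs -/

lemma ReformFeasible.exists_isSCARun (hT : 0 < S.T) (hσn : 0 < S.σn) (hη : 0 < S.η)
    {x₀ : SCAState M K Nt} {q : Fin M → ℝ} (h : S.ReformFeasible x₀ q) :
    ∃ x, S.IsSCARun x ∧ x 0 = x₀ := by
  have hnext : ∀ x : {x // ∃ q, S.ReformFeasible x q}, ∃ y : {x // ∃ q, S.ReformFeasible x q},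
      S.IsSurrogateSolution x y := by
    rintro ⟨x, q, hx⟩
    obtain ⟨y, q', hy, hopt⟩ := hx.exists_isSurrogateSolution hT hσn hη
    exact ⟨⟨y, q', hy.reformFeasible hσn⟩, q', hy, hopt⟩
  choose next hnext using hnext
  refine ⟨fun n => (next^[n] ⟨x₀, q, h⟩).1, ⟨⟨q, h⟩, fun r => ?_⟩, rfl⟩
  rw [Function.iterate_succ_apply']
  exact hnext _

namespace IsSCARun

variable {x : ℕ → SCAState M K Nt}

lemma reformFeasible (hT : 0 < S.T) (hσn : 0 < S.σn) (hx : S.IsSCARun x) (r : ℕ) :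
    S.ReformFeasible (x r) (S.gain (x r).f) := by
  induction r with
  | zero =>
    obtain ⟨q, hq⟩ := hx.init
    exact hq.with_gain hT
  | succ r _ =>
    obtain ⟨q, hq, -⟩ := hx.step r
    exact (hq.reformFeasible hσn).with_gain hT

lemma crlb_succ_le (hT : 0 < S.T) (hσn : 0 < S.σn) (hx : S.IsSCARun x) {r : ℕ}
    {y : SCAState M K Nt} {q : Fin M → ℝ} (hy : S.SurrogateFeasible (x r) y q) :
    S.crlb (x (r + 1)).f ≤ S.traceInv q := by
  obtain ⟨q', hq', hopt⟩ := hx.step r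
  exact ((hq'.reformFeasible hσn).crlb_le hT).trans (hopt y q hy)

lemma antitone_crlb (hT : 0 < S.T) (hσn : 0 < S.σn) (hx : S.IsSCARun x) :
    Antitone fun r => S.crlb (x r).f :=
  antitone_nat_of_succ_le fun r =>
    hx.crlb_succ_le hT hσn ((hx.reformFeasible hT hσn r).surrogateFeasible_self hσn)

/-- A repeated beamformer is a KKT point, since otherwise the next iterate would strictly decrease
the bound. -/
lemma isKKTPoint_of_eq (hT : 0 < S.T) (hσn : 0 < S.σn) (hη : 0 < S.η)
    (hslater : ∃ f : Beamformers M K Nt, (∀ m, power f m ≤ S.P) ∧ ∀ m k, S.η < S.sinr f m k)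
    (hx : S.IsSCARun x) {r : ℕ} (h : (x (r + 1)).f = (x r).f) : S.IsKKTPoint (x r).f := by
  by_contra hno
  have hr := hx.reformFeasible hT hσn r
  obtain ⟨y, q, hy, hlt⟩ := hr.exists_strictly_better hT hσn hη hslater hno
  have hev := hy.eventually (l := pure ()) (z := fun _ => x r) tendsto_const_nhds
    tendsto_const_nhds tendsto_const_nhds (hr.u_pos hσn)
  have := hx.crlb_succ_le hT hσn (eventually_pure.1 hev)
  rw [h] at this
  linarith

end IsSCARun

/-- Admissibility passes to limits along which the bound does not blow up. -/
lemma ReformFeasible.of_tendsto (hσn : 0 < S.σn) {z : ℕ → SCAState M K Nt}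
    {x : SCAState M K Nt} {c : ℝ} (h : ∀ r, S.ReformFeasible (z r) (S.gain (z r).f))
    (hc : ∀ r, S.crlb (z r).f ≤ c) (hf : Tendsto (fun r => (z r).f) atTop (𝓝 x.f))
    (hρ : Tendsto (fun r => (z r).ρ) atTop (𝓝 x.ρ))
    (hu : Tendsto (fun r => (z r).u) atTop (𝓝 x.u)) : S.ReformFeasible x (S.gain x.f) := by
  have hρ' : ∀ m k, Tendsto (fun r => (z r).ρ m k) atTop (𝓝 (x.ρ m k)) := fun m k =>
    tendsto_pi_nhds.1 (tendsto_pi_nhds.1 hρ m) k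
  have hu' : ∀ m k, Tendsto (fun r => (z r).u m k) atTop (𝓝 (x.u m k)) := fun m k =>
    tendsto_pi_nhds.1 (tendsto_pi_nhds.1 hu m) k
  have hc0 : 0 < c := (S.traceInv_pos (h 0).dom).trans_le (hc 0)
  have hnoise : ∀ m k, S.σn ^ 2 + S.interference x.f m k ≤ x.u m k := fun m k =>
    le_of_tendsto_of_tendsto' ((((S.continuous_interference m k).tendsto _).comp hf).const_add _)
      (hu' m k) fun r => (h r).noise m k
  have hupos : ∀ m k, 0 < x.u m k := fun m k =>
    (S.noise_pos hσn x.f m k).trans_le (by linarith [hnoise m k])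
  refine ⟨?_, fun m => ?_, fun _ => le_rfl, fun m k => ?_, fun m k => ?_, hnoise⟩
  · exact ((S.isClosed_traceInv_le hc0).mem_of_tendsto ((S.continuous_gain.tendsto _).comp hf)
      (Eventually.of_forall fun r => ⟨(h r).dom, hc r⟩)).1
  · exact le_of_tendsto' (((continuous_power m).tendsto _).comp hf) fun r => (h r).power_le m
  · exact ge_of_tendsto' (((hρ' m k).pow 2).div (hu' m k) (hupos m k).ne') fun r => (h r).ratio m k
  · exact le_of_tendsto_of_tendsto' ((hρ' m k).pow 2)
      (((S.continuous_signal m k).tendsto _).comp hf) fun r => (h r).signal m k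

/-- Limit points of a run are KKT points: near a limit point that is not one, the surrogate
problems would have a common feasible point whose value lies below the limit of the bounds. -/
lemma IsSCARun.isKKTPoint_and_tendsto (hT : 0 < S.T) (hσn : 0 < S.σn) (hη : 0 < S.η)
    (hslater : ∃ f : Beamformers M K Nt, (∀ m, power f m ≤ S.P) ∧ ∀ m k, S.η < S.sinr f m k)
    {x : ℕ → SCAState M K Nt} (hx : S.IsSCARun x) {f : Beamformers M K Nt}
    (hf : MapClusterPt f atTop fun r => (x r).f) :
    S.IsKKTPoint f ∧ Tendsto (fun r => S.crlb (x r).f) atTop (𝓝 (S.crlb f)) := by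
  obtain ⟨ψ, hψ, hψf⟩ := hf.tendsto_subseq
  obtain ⟨C, hC, hmem⟩ := S.exists_isCompact_reformFeasible hσn hη
  obtain ⟨⟨f', ρ, u⟩, -, φ, hφ, hlim⟩ := hC.tendsto_subseq
    (x := fun n => ((x (ψ n)).f, (x (ψ n)).ρ, (x (ψ n)).u))
    fun n => hmem _ _ (hx.reformFeasible hT hσn (ψ n))
  have hf1 : Tendsto (fun n => (x (ψ (φ n))).f) atTop (𝓝 f') :=
    (continuous_fst.tendsto _).comp hlim
  have hρ1 : Tendsto (fun n => (x (ψ (φ n))).ρ) atTop (𝓝 ρ) :=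
    (continuous_fst.tendsto _).comp ((continuous_snd.tendsto _).comp hlim)
  have hu1 : Tendsto (fun n => (x (ψ (φ n))).u) atTop (𝓝 u) :=
    (continuous_snd.tendsto _).comp ((continuous_snd.tendsto _).comp hlim)
  obtain rfl : f' = f := tendsto_nhds_unique hf1 (hψf.comp hφ.tendsto_atTop)
  let z : SCAState M K Nt := ⟨f', ρ, u⟩
  have hanti := hx.antitone_crlb hT hσn
  have hz : S.ReformFeasible z (S.gain z.f) :=
    ReformFeasible.of_tendsto hσn (z := fun n => x (ψ (φ n))) (x := z)
      (fun n => hx.reformFeasible hT hσn _) (fun n => hanti (Nat.zero_le _)) hf1 hρ1 hu1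
  have hcrlb : Tendsto (fun n => S.crlb (x (ψ (φ n))).f) atTop (𝓝 (S.crlb f')) :=
    (S.differentiableAt_traceInv hz.dom).continuousAt.tendsto.comp
      ((S.continuous_gain.tendsto _).comp hf1)
  have hconv : Tendsto (fun r => S.crlb (x r).f) atTop (𝓝 (S.crlb f')) :=
    (tendsto_iff_tendsto_subseq_of_antitone hanti
      (hψ.tendsto_atTop.comp hφ.tendsto_atTop)).2 hcrlb
  refine ⟨?_, hconv⟩
  by_contra hno
  obtain ⟨y, q, hy, hlt⟩ := hz.exists_strictly_better hT hσn hη hslater hno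
  obtain ⟨n, hn⟩ :=
    (hy.eventually (z := fun n => x (ψ (φ n))) hf1 hρ1 hu1 (hz.u_pos hσn)).exists
  have h1 := hx.crlb_succ_le hT hσn hn
  have h2 := hanti.le_of_tendsto hconv (ψ (φ n) + 1)
  exact absurd (h2.trans h1) (not_le.2 hlt)

end ISACNetwork

end

theorem corollary1 {M K N Nt : ℕ} (S : ISACNetwork M K N Nt)
    (hT : 0 < S.T) (hβ : 0 < S.β) (hσs : 0 < S.σs) (hσn : 0 < S.σn) (hη : 0 < S.η)
    (hslater : ∃ f : Beamformers M K Nt,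
      (∀ m, ISACNetwork.power f m ≤ S.P) ∧ ∀ m k, S.η < S.sinr f m k) :
    -- the algorithm can be started at every feasible point and never gets stuck
    (∀ f₀, S.Feasible f₀ → ∃ x, S.IsSCARun x ∧ (x 0).f = f₀) ∧
    (∀ x q, S.ReformFeasible x q → ∃ y, S.IsSurrogateSolution x y) ∧
    -- convergence of every run
    ∀ x : ℕ → SCAState M K Nt, S.IsSCARun x →
      (∀ r, S.Feasible (x r).f) ∧
      Antitone (fun r => S.crlb (x r).f) ∧
      (∃ f, MapClusterPt f atTop (fun r => (x r).f)) ∧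
      (∀ f, MapClusterPt f atTop (fun r => (x r).f) →
        S.IsKKTPoint f ∧ Tendsto (fun r => S.crlb (x r).f) atTop (𝓝 (S.crlb f))) ∧
      Tendsto (fun r => Metric.infDist (x r).f {f | S.IsKKTPoint f}) atTop (𝓝 0) ∧
      (∀ r, (x (r + 1)).f = (x r).f → S.IsKKTPoint (x r).f) := by
  refine ⟨fun f₀ h => ?_, fun x q h => h.exists_isSurrogateSolution hT hσn hη, fun x hx => ?_⟩
  · obtain ⟨x, hx, hx0⟩ := h.reformFeasible.exists_isSCARun hT hσn hη
    exact ⟨x, hx, by rw [hx0]; rfl⟩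
  have hcomp := ISACNetwork.isCompact_power_le (M := M) (K := K) (Nt := Nt) S.P
  have hmem : ∀ r, (x r).f ∈ {f : Beamformers M K Nt | ∀ m, ISACNetwork.power f m ≤ S.P} :=
    fun r => (hx.reformFeasible hT hσn r).power_le
  have hkkt := fun f hf => hx.isKKTPoint_and_tendsto hT hσn hη hslater (f := f) hf
  refine ⟨fun r => (hx.reformFeasible hT hσn r).feasible hT hσn hη, hx.antitone_crlb hT hσn,
    ?_, hkkt, ?_, fun r h => hx.isKKTPoint_of_eq hT hσn hη hslater h⟩
  · obtain ⟨f, -, φ, hφ, hlim⟩ := hcomp.tendsto_subseq hmem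
    exact ⟨f, hlim.mapClusterPt.of_comp hφ.tendsto_atTop⟩
  · refine tendsto_of_subseq_tendsto fun ns hns => ?_
    obtain ⟨f, -, φ, hφ, hlim⟩ := hcomp.tendsto_subseq fun n => hmem (ns n)
    have hf := (hkkt f (hlim.mapClusterPt.of_comp (hns.comp hφ.tendsto_atTop))).1
    refine ⟨φ, squeeze_zero (fun _ => Metric.infDist_nonneg)
      (fun n => Metric.infDist_le_dist_of_mem (show f ∈ {f | S.IsKKTPoint f} from hf)) ?_⟩
    exact tendsto_iff_dist_tendsto_zero.1 hlim
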